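/- Let $\mathcal T,\mathrm{Kn},\lambda_{bc},\lambda_{ini}>0$ and let $M=(C_{\rho,\min},C_{\rho,\max},C_{u,\max},C_{T,\min},C_{T,\max},C_\infty)$ be positive constants. For $g\ge 0$ on $\mathbb R^3$ put $\rho_g=\int g\,dv$, $u_g=\rho_g^{-1}\int v g\,dv$, $T_g=(3\rho_g)^{-1}\int|v-u_g|^2g\,dv$ and $\mathcal M[g](v)=\rho_g(2\pi T_g)^{-3/2}e^{-|v-u_g|^2/(2T_g)}$. Let $L^1_2(\mathbb R^3)=L^1((1+|v|^2)dv)$, and let $\mathcal X_M$ be the set of non-negative $f\in C^1([0,\mathcal T]\times[0,1]^3;L^1_2(\mathbb R^3_v)\cap L^2(\mathbb R^3_v))$ with $C_{\rho,\min}\le\rho_f\le C_{\rho,\max}$, $C_{T,\min}\le T_f\le C_{T,\max}$, $|u_f|\le C_{u,\max}$ for all $(t,x)$ and $\operatorname{ess\,sup}_{t,x}\|f(t,x,\cdot)\|_{L^2(\mathbb R^3)}\le C_\infty$. There is a constant $c_M>0$ such that, for some $L_M>0$ (both depending only on $M$), all $f,g\in\mathcal X_M$ satisfy, for all $(t,x,v)\in[0,\mathcal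 T]\times[0,1]^3\times\mathbb R^3$, $$|\mathcal M[f]-\mathcal M[g]|(t,x,v)\le L_Me^{-c_M|v|^2}\int_{\mathbb R^3}(1+|v_*|^2)|f-g|(t,x,v_*)\,dv_* .$$ For every such $c_M$ the following holds. Let $w:\mathbb R^3\to[1,\infty)$ be a weight with $$\int_{\mathbb R^3}\frac{(1+|v|^2)^2}{w(v)^2}\,dv<\infty,\qquad\int_{\mathbb R^3}w(v)^2e^{-2c_M|v|^2}\,dv<\infty .$$ Let $f\in\mathcal X_M$ solve $\partial_tf+v\cdot\nabla_xf=\frac1{\mathrm{Kn}}(\mathcal M[f]-f)$ in $(0,\mathcal T)\times(0,1)^3\times\mathbb R^3$ (for almost every $v$) with $f(0,x,v)=f_0(x,v)$ and periodic boundary conditions in $x\in[0,1]^3$. For $\tilde f\in\mathcal X_M$ (not necessarily periodic) let $$\begin{aligned}\mathcal L_{w\text{-PINN}}(\tilde f)={}&\int_0^{\mathcal T}\!\!\int_{\mathbb R^3}\int_{[0,1]^3}\Big|w\Big(\partial_t\tilde f+v\cdot\nabla_x\tilde f-\tfrac1{\mathrm{Kn}}(\mathcal M[\tilde f]-\tilde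 f)\Big)\Big|^2dx\,dv\,dt\\&+\lambda_{bc}\sum_{i=1}^3\int_0^{\mathcal T}\!\!\int_{\mathbb R^3}\int_{[0,1]^2}\big|v_iw^2\big(\tilde f|_{x_i=1}-\tilde f|_{x_i=0}\big)\big|^2d\hat x_i\,dv\,dt\\&+\lambda_{ini}\int_{\mathbb R^3}\int_{[0,1]^3}\big|w\,(\tilde f(0,x,v)-f_0(x,v))\big|^2dx\,dv\ \in[0,\infty].\end{aligned}$$ Then, as $\mathcal L_{w\text{-PINN}}(\tilde f)\to0$ with $\tilde f\in\mathcal X_M$ (that is, along every family, indexed by any filter, of functions $\tilde f\in\mathcal X_M$ whose losses tend to $0$), for every $t\in[0,\mathcal T]$ $$\|w(f-\tilde f)(t)\|_{L^2([0,1]^3\times\mathbb R^3)}\to0,\qquad\|(f-\tilde f)(t)\|_{L^p([0,1]^3\times\mathbb R^3)}\to0\quad\text{for all }1\le p\le2 .$$ -/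

import Mathlib

open MeasureTheory Set Filter Topology
open scoped ENNReal

noncomputable section

namespace BGK

/-- Velocities `v ∈ ℝ³`, with the Euclidean norm. -/
abbrev Vel := EuclideanSpace ℝ (Fin 3)

/-- Positions `x ∈ ℝ³`. -/
abbrev Pos := Fin 3 → ℝ

/-- The spatial domain `[0,1]³`. -/
def cube : Set Pos := Set.Icc 0 1

/-- The time-space domain `[0,𝒯] × [0,1]³`. -/
def timeSpace (𝒯 : ℝ) : Set (ℝ × Pos) := Set.Icc 0 𝒯 ×ˢ cube

/-- The measure `(1 + |v|²) dv`; its `L¹` space is `L¹₂(ℝ³)`. -/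
def momentMeasure : Measure Vel :=
  volume.withDensity (fun v => ENNReal.ofReal (1 + ‖v‖ ^ 2))

theorem momentMeasure_ac : momentMeasure ≪ (volume : Measure Vel) :=
  withDensity_absolutelyContinuous _ _

theorem ac_momentMeasure : (volume : Measure Vel) ≪ momentMeasure := by
  refine withDensity_absolutelyContinuous' ?_ ?_
  · fun_prop
  · refine Eventually.of_forall fun v => ?_
    have : 0 < 1 + ‖v‖ ^ 2 := by positivity
    simpa using this

/-- `L¹₂(ℝ³) ∩ L²(ℝ³)`: an element of `L¹₂` and an element of `L²` that are the same function
almost everywhere. The norm is the larger one of the `L¹₂` and `L²` norms. -/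
def velSubmodule :
    Submodule ℝ (Lp ℝ 1 momentMeasure × Lp ℝ 2 (volume : Measure Vel)) where
  carrier := {g | (g.1 : Vel → ℝ) =ᵐ[volume] (g.2 : Vel → ℝ)}
  zero_mem' := by
    have h1 := ac_momentMeasure.ae_eq (Lp.coeFn_zero ℝ 1 momentMeasure)
    have h2 := Lp.coeFn_zero ℝ 2 (volume : Measure Vel)
    exact h1.trans h2.symm
  add_mem' := by
    intro a b ha hb
    change (a.1 : Vel → ℝ) =ᵐ[volume] (a.2 : Vel → ℝ) at ha
    change (b.1 : Vel → ℝ) =ᵐ[volume] (b.2 : Vel → ℝ) at hb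
    have h1 := ac_momentMeasure.ae_eq (Lp.coeFn_add a.1 b.1)
    have h2 := Lp.coeFn_add a.2 b.2
    exact h1.trans ((ha.add hb).trans h2.symm)
  smul_mem' := by
    intro c a ha
    change (a.1 : Vel → ℝ) =ᵐ[volume] (a.2 : Vel → ℝ) at ha
    have h1 := ac_momentMeasure.ae_eq (Lp.coeFn_smul c a.1)
    have h2 := Lp.coeFn_smul c a.2
    exact h1.trans ((ha.const_smul c).trans h2.symm)

/-- The normed space `L¹₂(ℝ³) ∩ L²(ℝ³)`. -/
abbrev VelSpace := ↥velSubmodule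

/-- The function of the velocity (defined up to null sets) given by an element of
`L¹₂(ℝ³) ∩ L²(ℝ³)`. -/
def VelSpace.fn (g : VelSpace) : Vel → ℝ := (g.1.2 : Vel → ℝ)

/-- The density `ρ = ∫ g dv`. -/
def density (g : Vel → ℝ) : ℝ := ∫ v, g v

/-- The bulk velocity `u = ρ⁻¹ ∫ v g dv`. -/
def bulkVelocity (g : Vel → ℝ) : Vel := (density g)⁻¹ • ∫ v, g v • v

/-- The temperature `T = (3ρ)⁻¹ ∫ |v - u|² g dv`. -/
def temperature (g : Vel → ℝ) : ℝ :=
  (3 * density g)⁻¹ * ∫ v, ‖v - bulkVelocity g‖ ^ 2 * g v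

/-- The Maxwellian with density `ρ`, velocity `u` and temperature `T`. -/
def maxwellian (ρ : ℝ) (u : Vel) (T : ℝ) (v : Vel) : ℝ :=
  ρ / (2 * Real.pi * T) ^ (3 / 2 : ℝ) * Real.exp (-‖v - u‖ ^ 2 / (2 * T))

/-- The local Maxwellian `ℳ[g]` of a velocity distribution `g`. -/
def localMaxwellian (g : Vel → ℝ) : Vel → ℝ :=
  maxwellian (density g) (bulkVelocity g) (temperature g)

/-- The structural constants
`M = (C_{ρ,min}, C_{ρ,max}, C_{u,max}, C_{T,min}, C_{T,max}, C_∞)`, all positive. -/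
structure StructuralConstants where
  ρmin : ℝ
  ρmax : ℝ
  umax : ℝ
  Tmin : ℝ
  Tmax : ℝ
  Cinf : ℝ
  ρmin_pos : 0 < ρmin
  ρmax_pos : 0 < ρmax
  umax_pos : 0 < umax
  Tmin_pos : 0 < Tmin
  Tmax_pos : 0 < Tmax
  Cinf_pos : 0 < Cinf

/-- The ansatz space `𝒳_M`: nonnegative `f ∈ C¹([0,𝒯] × [0,1]³; L¹₂(ℝ³) ∩ L²(ℝ³))` with
uniformly bounded macroscopic fields and uniformly bounded `L²(ℝ³)` norm. -/
structure InAnsatz (M : StructuralConstants) (𝒯 : ℝ) (f : ℝ × Pos → VelSpace) : Prop where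
  contDiffOn : ContDiffOn ℝ 1 f (timeSpace 𝒯)
  nonneg : ∀ z ∈ timeSpace 𝒯, ∀ᵐ v, 0 ≤ (f z).fn v
  density_mem : ∀ z ∈ timeSpace 𝒯, density (f z).fn ∈ Set.Icc M.ρmin M.ρmax
  temperature_mem : ∀ z ∈ timeSpace 𝒯, temperature (f z).fn ∈ Set.Icc M.Tmin M.Tmax
  bulkVelocity_le : ∀ z ∈ timeSpace 𝒯, ‖bulkVelocity (f z).fn‖ ≤ M.umax
  norm_le : essSup (fun z => eLpNorm (f z).fn 2 volume) (volume.restrict (timeSpace 𝒯))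
    ≤ ENNReal.ofReal M.Cinf

/-- `∂ₜ f (t,x)` as a function of the velocity: the derivative of the
`L¹₂ ∩ L²`-valued map `f` (one-sided at the boundary of the domain). -/
def timeDeriv (𝒯 : ℝ) (f : ℝ × Pos → VelSpace) (t : ℝ) (x : Pos) : Vel → ℝ :=
  (fderivWithin ℝ f (timeSpace 𝒯) (t, x) (1, 0)).fn

/-- `∂_{xᵢ} f (t,x)` as a function of the velocity. -/
def spaceDeriv (𝒯 : ℝ) (f : ℝ × Pos → VelSpace) (i : Fin 3) (t : ℝ) (x : Pos) : Vel → ℝ :=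
  (fderivWithin ℝ f (timeSpace 𝒯) (t, x) (0, Pi.single i 1)).fn

/-- `∂ₜ f + v · ∇ₓ f`. -/
def transport (𝒯 : ℝ) (f : ℝ × Pos → VelSpace) (t : ℝ) (x : Pos) (v : Vel) : ℝ :=
  timeDeriv 𝒯 f t x v + ∑ i, v i * spaceDeriv 𝒯 f i t x v

/-- The relaxation term `Kn⁻¹ (ℳ[f] - f)`. -/
def relaxation (Kn : ℝ) (f : ℝ × Pos → VelSpace) (t : ℝ) (x : Pos) (v : Vel) : ℝ :=
  1 / Kn * (localMaxwellian (f (t, x)).fn v - (f (t, x)).fn v)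

/-- `f` solves the BGK problem on `[0,𝒯] × [0,1]³ × ℝ³` with initial datum `f₀` and periodic
boundary conditions. The point `i.insertNth a y` has `i`-th coordinate `a` and its
remaining coordinates are those of `y`. -/
structure IsSolution (𝒯 Kn : ℝ) (f₀ : Pos → Vel → ℝ) (f : ℝ × Pos → VelSpace) : Prop where
  equation : ∀ t ∈ Set.Ioo 0 𝒯, ∀ x : Pos, (∀ i, x i ∈ Set.Ioo (0 : ℝ) 1) →
    ∀ᵐ v, transport 𝒯 f t x v = relaxation Kn f t x v
  initial : ∀ x ∈ cube, ∀ᵐ v, (f (0, x)).fn v = f₀ x v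
  periodic : ∀ t ∈ Set.Icc 0 𝒯, ∀ i : Fin 3, ∀ y ∈ Set.Icc (0 : Fin 2 → ℝ) 1,
    f (t, i.insertNth (1 : ℝ) y) = f (t, i.insertNth (0 : ℝ) y)

/-- The weighted loss of the equation,
`∫₀^𝒯 ∫ ∫ |w (∂ₜ f + v·∇ₓ f - Kn⁻¹(ℳ[f] - f))|² dv dx dt`, possibly `∞`.
Here and below the velocity integral is the innermost one, because for fixed `(t,x)` the
integrand is a function of `v` up to null sets; the integrands are nonnegative. -/
def lossPde (𝒯 Kn : ℝ) (w : Vel → ℝ) (f : ℝ × Pos → VelSpace) : ℝ≥0∞ :=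
  ∫⁻ t in Set.Icc 0 𝒯, ∫⁻ x in cube, ∫⁻ v,
    ‖w v * (transport 𝒯 f t x v - relaxation Kn f t x v)‖ₑ ^ 2

/-- The weighted loss of the periodic boundary condition. -/
def lossBc (𝒯 : ℝ) (w : Vel → ℝ) (f : ℝ × Pos → VelSpace) : ℝ≥0∞ :=
  ∑ i : Fin 3, ∫⁻ t in Set.Icc 0 𝒯, ∫⁻ y in Set.Icc (0 : Fin 2 → ℝ) 1, ∫⁻ v,
    ‖v i * w v ^ 2 *
      ((f (t, i.insertNth (1 : ℝ) y)).fn v - (f (t, i.insertNth (0 : ℝ) y)).fn v)‖ₑ ^ 2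

/-- The weighted loss of the initial condition. -/
def lossIni (w : Vel → ℝ) (f₀ : Pos → Vel → ℝ) (f : ℝ × Pos → VelSpace) : ℝ≥0∞ :=
  ∫⁻ x in cube, ∫⁻ v, ‖w v * ((f (0, x)).fn v - f₀ x v)‖ₑ ^ 2

/-- The weighted PINN loss. -/
def weightedLoss (𝒯 Kn lamBc lamIni : ℝ) (w : Vel → ℝ) (f₀ : Pos → Vel → ℝ)
    (f : ℝ × Pos → VelSpace) : ℝ≥0∞ :=
  lossPde 𝒯 Kn w f + ENNReal.ofReal lamBc * lossBc 𝒯 w f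
    + ENNReal.ofReal lamIni * lossIni w f₀ f

/-- The norm of `L^p([0,1]³ × ℝ³)`, possibly `∞`. -/
def phaseNorm (p : ℝ) (g : Pos → Vel → ℝ) : ℝ≥0∞ :=
  (∫⁻ x in cube, ∫⁻ v, ‖g x v‖ₑ ^ p) ^ (1 / p)

/-- `c` is an admissible exponent `c_M > 0` in the Lipschitz-type continuity of the local
Maxwellian on `𝒳_M`: with a constant `L` depending only on `M`,
`|ℳ[f] - ℳ[g]|(t,x,v) ≤ L exp(-c|v|²) ∫ (1+|v'|²) |f - g|(t,x,v') dv'` for `f, g ∈ 𝒳_M`. -/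
def IsMaxwellianExponent (M : StructuralConstants) (c : ℝ) : Prop :=
  0 < c ∧ ∃ L : ℝ, 0 < L ∧ ∀ 𝒯 : ℝ, 0 < 𝒯 → ∀ f g : ℝ × Pos → VelSpace,
    InAnsatz M 𝒯 f → InAnsatz M 𝒯 g → ∀ z ∈ timeSpace 𝒯, ∀ v : Vel,
      |localMaxwellian (f z).fn v - localMaxwellian (g z).fn v| ≤
        L * Real.exp (-c * ‖v‖ ^ 2) * ∫ v', (1 + ‖v'‖ ^ 2) * |(f z).fn v' - (g z).fn v'|

/-- Weights `w ≥ 1` satisfying the two integrability conditions with exponent `c`. -/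
structure IsAdmissibleWeight (c : ℝ) (w : Vel → ℝ) : Prop where
  one_le : ∀ v, 1 ≤ w v
  integrable_inv : Integrable (fun v => (1 + ‖v‖ ^ 2) ^ 2 / w v ^ 2)
  integrable_gauss : Integrable (fun v => w v ^ 2 * Real.exp (-2 * c * ‖v‖ ^ 2))

end BGK

end

/-!
The first claim is that the Maxwellian is Lipschitz in its parameters `(ρ, u, T)` on the compact
range allowed by `M`, with a Gaussian Lipschitz constant (`exists_abs_maxwellian_sub_le`), and that
the parameters are Lipschitz functions of the moments of order at most two
(`exists_macroscopic_sub_le`).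

The second claim is a weighted energy estimate for `R = f - f̃`. Formally, `|wR|²` satisfies a
balance law whose source consists of the Maxwellian difference, the damping `-|wR|²/Kn` and the
residual of `f̃`. The Maxwellian difference is at most `L e^{-c|v|²} ∫ (1+|v|²)|R|`; the two
conditions on the weight bound its contribution by a multiple of `‖wR‖²`. The boundary flux
`∫ vᵢ w² (R²|_{xᵢ=1} - R²|_{xᵢ=0})` factors into the boundary mismatch of `f̃`, weighted by `vᵢ w²`,
and a sum of values of `R`, which is bounded in `L²` by the constant `C_∞`. It is therefore linear
in the boundary mismatch, and Young's inequality with a parameter `η` trades it for `η` plus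
`η⁻¹` times the boundary loss. Grönwall's inequality then gives `exists_weighted_stability`, and the
convergence follows by sending first the loss and then `η` to zero.

Since `wR` is not known to be square integrable beforehand, the estimate is carried out for the
weight cut off to the set where `|v| ≤ n` and `w ≤ n` (`truncWeight`). The cut-off energy is then a
continuous quadratic form on `L²(ℝ³)` evaluated along a `C¹` map, so that it is a `C¹` function of
`(t,x)` (`contDiffOn_quadForm`) and the divergence theorem applies (`energy_le`). The price is an
error: the part of `∫ (1+|v|²)|R|` outside the cut-off set (`tail`), which tends to zero
as `n → ∞` for fixed `f̃`; Fatou's lemma then removes the cut-off.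

The `L^p` statement follows from the weighted one, since
`|R|^p ≤ |R| + |R|² ≤ δ w⁻² + (δ⁻¹ + 1) |wR|²` and `w⁻²` is integrable (`rpow_enorm_le`).
-/

noncomputable section

namespace BGK

/-! ### Lipschitz continuity of the Maxwellian in its parameters -/

theorem abs_log_sub_log_le {m a b : ℝ} (hm : 0 < m) (ha : m ≤ a) (hb : m ≤ b) :
    |Real.log a - Real.log b| ≤ |a - b| / m := by
  have key : ∀ {a b : ℝ}, m ≤ a → m ≤ b → Real.log a - Real.log b ≤ |a - b| / m := by
    intro a b ha hb
    have ha' : 0 < a := hm.trans_le ha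
    have hb' : 0 < b := hm.trans_le hb
    rw [← Real.log_div ha'.ne' hb'.ne']
    calc Real.log (a / b) ≤ a / b - 1 := Real.log_le_sub_one_of_pos (by positivity)
      _ = (a - b) / b := by field_simp
      _ ≤ |a - b| / b := by gcongr; exact le_abs_self _
      _ ≤ |a - b| / m := by gcongr
  rw [abs_le]
  constructor
  · have := key hb ha
    rw [abs_sub_comm] at this
    linarith
  · exact key ha hb

theorem abs_exp_sub_exp_le {a b B : ℝ} (ha : Real.exp a ≤ B) (hb : Real.exp b ≤ B) :
    |Real.exp a - Real.exp b| ≤ B * |a - b| := by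
  have key : ∀ {a b : ℝ}, Real.exp a ≤ B → Real.exp a - Real.exp b ≤ B * |a - b| := by
    intro a b ha
    have h1 : Real.exp b = Real.exp a * Real.exp (b - a) := by rw [← Real.exp_add]; ring_nf
    have h2 := Real.add_one_le_exp (b - a)
    have h3 := Real.exp_pos a
    calc Real.exp a - Real.exp b ≤ Real.exp a * (a - b) := by rw [h1]; nlinarith
      _ ≤ Real.exp a * |a - b| := by gcongr; exact le_abs_self _
      _ ≤ B * |a - b| := by gcongr
  rw [abs_le]
  constructor
  · have := key (a := b) (b := a) hb
    rw [abs_sub_comm] at this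
    linarith
  · exact key ha

theorem maxwellian_eq_exp {ρ T : ℝ} (hρ : 0 < ρ) (hT : 0 < T) (u v : Vel) :
    maxwellian ρ u T v =
      Real.exp (Real.log ρ - 3 / 2 * Real.log (2 * Real.pi * T) - ‖v - u‖ ^ 2 / (2 * T)) := by
  have h2 : 0 < 2 * Real.pi * T := by positivity
  rw [maxwellian, Real.exp_sub, Real.exp_sub, Real.exp_log hρ, Real.rpow_def_of_pos h2,
    mul_comm (Real.log _), neg_div, Real.exp_neg]
  rfl

theorem norm_sq_le_two_mul_norm_sub_sq (u v : Vel) : ‖v‖ ^ 2 ≤ 2 * ‖v - u‖ ^ 2 + 2 * ‖u‖ ^ 2 := by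
  have h : ‖v‖ ≤ ‖v - u‖ + ‖u‖ := by simpa using norm_add_le (v - u) u
  nlinarith [norm_nonneg v, norm_nonneg u, norm_nonneg (v - u), sq_nonneg (‖v - u‖ - ‖u‖)]

/-- A Gaussian upper bound that holds for all Maxwellians with parameters in the range given by `M`;
half of the decay rate is lost in passing from `|v - u|²` to `|v|²`. -/
theorem maxwellian_le (M : StructuralConstants) {ρ T : ℝ} {u : Vel}
    (hρ : ρ ∈ Icc M.ρmin M.ρmax) (hT : T ∈ Icc M.Tmin M.Tmax) (hu : ‖u‖ ≤ M.umax) (v : Vel) :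
    maxwellian ρ u T v ≤ M.ρmax / (2 * Real.pi * M.Tmin) ^ (3 / 2 : ℝ) *
      Real.exp (M.umax ^ 2 / (2 * M.Tmax)) * Real.exp (-‖v‖ ^ 2 / (4 * M.Tmax)) := by
  have hTm := M.Tmin_pos
  have hTM := M.Tmax_pos
  have hρM := M.ρmax_pos
  have hT0 : 0 < T := hTm.trans_le hT.1
  have hρ0 : 0 < ρ := M.ρmin_pos.trans_le hρ.1
  have hpi := Real.pi_pos
  rw [maxwellian, mul_assoc (M.ρmax / _), ← Real.exp_add]
  gcongr
  · exact hρ.2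
  · exact hT.1
  · have h1 : ‖v - u‖ ^ 2 / (2 * M.Tmax) ≤ ‖v - u‖ ^ 2 / (2 * T) := by gcongr; exact hT.2
    have h2 := norm_sq_le_two_mul_norm_sub_sq u v
    have h3 : ‖u‖ ^ 2 ≤ M.umax ^ 2 := by gcongr
    have h4 : ‖v‖ ^ 2 / (4 * M.Tmax) ≤ (2 * ‖v - u‖ ^ 2 + 2 * M.umax ^ 2) / (4 * M.Tmax) := by
      gcongr; linarith
    have h5 : (2 * ‖v - u‖ ^ 2 + 2 * M.umax ^ 2) / (4 * M.Tmax)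
        = ‖v - u‖ ^ 2 / (2 * M.Tmax) + M.umax ^ 2 / (2 * M.Tmax) := by
      field_simp; ring
    rw [neg_div, neg_div]
    linarith

/-- The factor `1 + y²` is absorbed by giving up half of the Gaussian decay rate. -/
theorem one_add_sq_mul_exp_le {T : ℝ} (hT : 0 < T) (y : ℝ) :
    (1 + y ^ 2) * Real.exp (-y ^ 2 / (4 * T)) ≤
      (1 + 8 * T) * Real.exp (-(1 / (8 * T)) * y ^ 2) := by
  have h1 : -y ^ 2 / (4 * T) = -(1 / (8 * T)) * y ^ 2 - y ^ 2 / (8 * T) := by field_simp; ring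
  have h2 : 1 + y ^ 2 ≤ (1 + 8 * T) * Real.exp (y ^ 2 / (8 * T)) := by
    have h3 := Real.add_one_le_exp (y ^ 2 / (8 * T))
    have h4 : y ^ 2 = 8 * T * (y ^ 2 / (8 * T)) := by field_simp
    have h5 : 0 ≤ y ^ 2 / (8 * T) := by positivity
    calc 1 + y ^ 2 ≤ (1 + 8 * T) * (y ^ 2 / (8 * T) + 1) := by
          nlinarith
      _ ≤ _ := by gcongr
  rw [h1, Real.exp_sub, ← mul_div_assoc, div_le_iff₀ (Real.exp_pos _)]
  calc (1 + y ^ 2) * Real.exp (-(1 / (8 * T)) * y ^ 2)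
      ≤ ((1 + 8 * T) * Real.exp (y ^ 2 / (8 * T))) * Real.exp (-(1 / (8 * T)) * y ^ 2) := by gcongr
    _ = _ := by ring

theorem abs_sq_div_sub_sq_div_le {m a b S T U y : ℝ} (hm : 0 < m) (hS : m ≤ S) (hT : m ≤ T)
    (ha : |a| ≤ y + U) (hb : |b| ≤ y + U) :
    |a ^ 2 / (2 * S) - b ^ 2 / (2 * T)| ≤
      (y + U) / m * |a - b| + (y + U) ^ 2 / (2 * m ^ 2) * |S - T| := by
  have hS0 : 0 < S := hm.trans_le hS
  have hT0 : 0 < T := hm.trans_le hT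
  have hyU : 0 ≤ y + U := (abs_nonneg _).trans ha
  have e : a ^ 2 / (2 * S) - b ^ 2 / (2 * T) =
      (a + b) * (a - b) / (2 * S) + b ^ 2 * (T - S) / (2 * (S * T)) := by
    field_simp; ring
  rw [e]
  refine (abs_add_le _ _).trans (add_le_add ?_ ?_)
  · rw [abs_div, abs_mul, abs_of_pos (by positivity : 0 < 2 * S)]
    have : |a + b| ≤ 2 * (y + U) := (abs_add_le _ _).trans (by linarith)
    calc |a + b| * |a - b| / (2 * S) ≤ 2 * (y + U) * |a - b| / (2 * m) := by gcongr
      _ = _ := by field_simp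
  · rw [abs_div, abs_mul, abs_of_pos (by positivity : 0 < 2 * (S * T)), abs_sub_comm T S, abs_pow]
    calc |b| ^ 2 * |S - T| / (2 * (S * T)) ≤ (y + U) ^ 2 * |S - T| / (2 * (m * m)) := by gcongr
      _ = _ := by field_simp

/-- On a compact range of parameters the Maxwellian is Lipschitz in `(ρ, u, T)`, with a Gaussian
Lipschitz constant: its logarithm is Lipschitz with a constant of order `1 + |v|²`, and this
factor is absorbed by a part of the Gaussian decay. -/
theorem exists_abs_maxwellian_sub_le (M : StructuralConstants) :
    ∃ K : ℝ, 0 < K ∧ ∀ ρ₁ ∈ Icc M.ρmin M.ρmax, ∀ ρ₂ ∈ Icc M.ρmin M.ρmax,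
      ∀ T₁ ∈ Icc M.Tmin M.Tmax, ∀ T₂ ∈ Icc M.Tmin M.Tmax,
      ∀ u₁ u₂ : Vel, ‖u₁‖ ≤ M.umax → ‖u₂‖ ≤ M.umax → ∀ v : Vel,
      |maxwellian ρ₁ u₁ T₁ v - maxwellian ρ₂ u₂ T₂ v| ≤
        K * Real.exp (-(1 / (8 * M.Tmax)) * ‖v‖ ^ 2) *
          (|ρ₁ - ρ₂| + ‖u₁ - u₂‖ + |T₁ - T₂|) := by
  have hTm := M.Tmin_pos
  have hTM := M.Tmax_pos
  have hρM := M.ρmax_pos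
  have hρm := M.ρmin_pos
  have hU := M.umax_pos
  have hpi := Real.pi_pos
  set A := M.ρmax / (2 * Real.pi * M.Tmin) ^ (3 / 2 : ℝ) * Real.exp (M.umax ^ 2 / (2 * M.Tmax))
    with hA
  have hA0 : 0 < A := by positivity
  set B := 1 / M.ρmin + 3 / (2 * M.Tmin) + (1 + M.umax) / M.Tmin +
    (1 + M.umax) ^ 2 / M.Tmin ^ 2 with hB
  have hB0 : 0 < B := by positivity
  refine ⟨A * (1 + 8 * M.Tmax) * B, by positivity, ?_⟩
  intro ρ₁ hρ₁ ρ₂ hρ₂ T₁ hT₁ T₂ hT₂ u₁ u₂ hu₁ hu₂ v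
  have hb1 := maxwellian_le M hρ₁ hT₁ hu₁ v
  have hb2 := maxwellian_le M hρ₂ hT₂ hu₂ v
  have hT₁0 := hTm.trans_le hT₁.1
  have hT₂0 := hTm.trans_le hT₂.1
  rw [maxwellian_eq_exp (hρm.trans_le hρ₁.1) hT₁0] at hb1 ⊢
  rw [maxwellian_eq_exp (hρm.trans_le hρ₂.1) hT₂0] at hb2 ⊢
  refine (abs_exp_sub_exp_le hb1 hb2).trans ?_
  set D := |ρ₁ - ρ₂| + ‖u₁ - u₂‖ + |T₁ - T₂| with hD
  have hD0 : 0 ≤ D := by positivity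
  have hDρ : |ρ₁ - ρ₂| ≤ D := by rw [hD]; linarith [norm_nonneg (u₁ - u₂), abs_nonneg (T₁ - T₂)]
  have hDu : ‖u₁ - u₂‖ ≤ D := by rw [hD]; linarith [abs_nonneg (ρ₁ - ρ₂), abs_nonneg (T₁ - T₂)]
  have hDT : |T₁ - T₂| ≤ D := by rw [hD]; linarith [norm_nonneg (u₁ - u₂), abs_nonneg (ρ₁ - ρ₂)]
  have h1 := abs_log_sub_log_le hρm hρ₁.1 hρ₂.1
  have h2 : |Real.log (2 * Real.pi * T₁) - Real.log (2 * Real.pi * T₂)| ≤ |T₁ - T₂| / M.Tmin := by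
    rw [Real.log_mul (by positivity) hT₁0.ne', Real.log_mul (by positivity) hT₂0.ne',
      add_sub_add_left_eq_sub]
    exact abs_log_sub_log_le hTm hT₁.1 hT₂.1
  have hva : ∀ u : Vel, ‖u‖ ≤ M.umax → |‖v - u‖| ≤ ‖v‖ + M.umax := fun u hu => by
    rw [abs_norm]; exact (norm_sub_le _ _).trans (by linarith)
  have h3 := abs_sq_div_sub_sq_div_le hTm hT₁.1 hT₂.1 (hva u₁ hu₁) (hva u₂ hu₂)
  have h4 : |‖v - u₁‖ - ‖v - u₂‖| ≤ ‖u₁ - u₂‖ := by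
    refine (abs_norm_sub_norm_le _ _).trans ?_
    rw [sub_sub_sub_cancel_left, norm_sub_rev]
  have hy := norm_nonneg v
  have hp1 : ‖v‖ + M.umax ≤ (1 + M.umax) * (1 + ‖v‖ ^ 2) := by
    nlinarith [sq_nonneg (‖v‖ - 1), mul_nonneg hU.le (sq_nonneg ‖v‖)]
  have hp2 : (‖v‖ + M.umax) ^ 2 ≤ 2 * ((1 + M.umax) ^ 2 * (1 + ‖v‖ ^ 2)) := by
    nlinarith [sq_nonneg (‖v‖ - M.umax), mul_nonneg hU.le (sq_nonneg ‖v‖),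
      mul_nonneg (sq_nonneg M.umax) (sq_nonneg ‖v‖)]
  have hp0 : 1 ≤ 1 + ‖v‖ ^ 2 := by nlinarith [sq_nonneg ‖v‖]
  have hlog : |(Real.log ρ₁ - 3 / 2 * Real.log (2 * Real.pi * T₁) - ‖v - u₁‖ ^ 2 / (2 * T₁)) -
      (Real.log ρ₂ - 3 / 2 * Real.log (2 * Real.pi * T₂) - ‖v - u₂‖ ^ 2 / (2 * T₂))| ≤
      B * (1 + ‖v‖ ^ 2) * D := by
    calc _ = |(Real.log ρ₁ - Real.log ρ₂) -
          3 / 2 * (Real.log (2 * Real.pi * T₁) - Real.log (2 * Real.pi * T₂)) -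
          (‖v - u₁‖ ^ 2 / (2 * T₁) - ‖v - u₂‖ ^ 2 / (2 * T₂))| := by congr 1; ring
      _ ≤ |Real.log ρ₁ - Real.log ρ₂| +
          3 / 2 * |Real.log (2 * Real.pi * T₁) - Real.log (2 * Real.pi * T₂)| +
          |‖v - u₁‖ ^ 2 / (2 * T₁) - ‖v - u₂‖ ^ 2 / (2 * T₂)| := by
        refine (abs_sub _ _).trans (add_le_add_left ((abs_sub _ _).trans ?_) _)
        rw [abs_mul, abs_of_pos (by norm_num : (0 : ℝ) < 3 / 2)]
      _ ≤ D / M.ρmin * (1 + ‖v‖ ^ 2) + 3 / 2 * (D / M.Tmin) * (1 + ‖v‖ ^ 2) +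
          ((1 + M.umax) * (1 + ‖v‖ ^ 2) / M.Tmin * D +
            2 * ((1 + M.umax) ^ 2 * (1 + ‖v‖ ^ 2)) / (2 * M.Tmin ^ 2) * D) := by
        refine add_le_add (add_le_add ?_ ?_) ?_
        · calc |Real.log ρ₁ - Real.log ρ₂| ≤ D / M.ρmin := h1.trans (by gcongr)
            _ ≤ _ := le_mul_of_one_le_right (by positivity) hp0
        · calc 3 / 2 * |Real.log (2 * Real.pi * T₁) - Real.log (2 * Real.pi * T₂)|
                ≤ 3 / 2 * (D / M.Tmin) := by gcongr; exact h2.trans (by gcongr)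
            _ ≤ _ := le_mul_of_one_le_right (by positivity) hp0
        · refine h3.trans ?_
          have := h4.trans hDu
          gcongr
      _ = B * (1 + ‖v‖ ^ 2) * D := by rw [hB]; field_simp; ring
  calc _ ≤ A * Real.exp (-‖v‖ ^ 2 / (4 * M.Tmax)) * (B * (1 + ‖v‖ ^ 2) * D) := by gcongr
    _ = A * B * D * ((1 + ‖v‖ ^ 2) * Real.exp (-‖v‖ ^ 2 / (4 * M.Tmax))) := by ring
    _ ≤ A * B * D * ((1 + 8 * M.Tmax) * Real.exp (-(1 / (8 * M.Tmax)) * ‖v‖ ^ 2)) := by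
        gcongr ?_ * ?_
        exact one_add_sq_mul_exp_le hTM _
    _ = _ := by ring

/-! ### Velocity moments -/

theorem VelSpace.fst_ae_eq (g : VelSpace) : (g.1.1 : Vel → ℝ) =ᵐ[volume] g.fn := g.2

theorem integrable_momentMeasure_iff {h : Vel → ℝ} :
    Integrable h momentMeasure ↔ Integrable (fun v => (1 + ‖v‖ ^ 2) * h v) := by
  rw [momentMeasure, integrable_withDensity_iff_integrable_smul' (by fun_prop)
    (Eventually.of_forall fun _ => ENNReal.ofReal_lt_top)]
  refine integrable_congr (Eventually.of_forall fun v => ?_)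
  simp [ENNReal.toReal_ofReal (by positivity : 0 ≤ 1 + ‖v‖ ^ 2)]

theorem VelSpace.integrable_moment (g : VelSpace) :
    Integrable (fun v => (1 + ‖v‖ ^ 2) * g.fn v) := by
  have h := L1.integrable_coeFn g.1.1
  rw [integrable_momentMeasure_iff] at h
  refine h.congr ?_
  filter_upwards [g.fst_ae_eq] with v hv
  rw [hv]

theorem VelSpace.aestronglyMeasurable (g : VelSpace) : AEStronglyMeasurable g.fn volume :=
  Lp.aestronglyMeasurable g.1.2

theorem VelSpace.memLp (g : VelSpace) : MemLp g.fn 2 volume := Lp.memLp g.1.2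

theorem integrable_moment_smul {E : Type*} [NormedAddCommGroup E] [NormedSpace ℝ E]
    {h : Vel → ℝ} (hm : AEStronglyMeasurable h volume)
    (hh : Integrable (fun v => (1 + ‖v‖ ^ 2) * h v)) {a : Vel → E} (ha : Continuous a)
    (hle : ∀ v, ‖a v‖ ≤ 1 + ‖v‖ ^ 2) : Integrable (fun v => h v • a v) := by
  refine hh.mono (hm.smul ha.aestronglyMeasurable) (Eventually.of_forall fun v => ?_)
  rw [norm_smul, norm_mul, mul_comm, Real.norm_of_nonneg (by positivity : 0 ≤ 1 + ‖v‖ ^ 2)]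
  gcongr
  exact hle v

theorem norm_integral_smul_le {E : Type*} [NormedAddCommGroup E] [NormedSpace ℝ E]
    {h : Vel → ℝ} (hh : Integrable (fun v => (1 + ‖v‖ ^ 2) * h v)) {a : Vel → E}
    (hle : ∀ v, ‖a v‖ ≤ 1 + ‖v‖ ^ 2) :
    ‖∫ v, h v • a v‖ ≤ ∫ v, (1 + ‖v‖ ^ 2) * |h v| := by
  refine norm_integral_le_of_norm_le ?_ (Eventually.of_forall fun v => ?_)
  · refine hh.norm.congr (Eventually.of_forall fun v => ?_)
    simp [abs_of_pos (by positivity : 0 < 1 + ‖v‖ ^ 2)]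
  · rw [norm_smul, mul_comm, Real.norm_eq_abs]
    gcongr
    exact hle v

theorem norm_le_one_add_sq (v : Vel) : ‖v‖ ≤ 1 + ‖v‖ ^ 2 := by
  nlinarith [sq_nonneg (‖v‖ - 1), sq_nonneg ‖v‖]

theorem VelSpace.integral_sub_smul {E : Type*} [NormedAddCommGroup E] [NormedSpace ℝ E]
    (f g : VelSpace) {a : Vel → E} (ha : Continuous a) (hle : ∀ v, ‖a v‖ ≤ 1 + ‖v‖ ^ 2) :
    ‖(∫ v, f.fn v • a v) - ∫ v, g.fn v • a v‖ ≤ ∫ v, (1 + ‖v‖ ^ 2) * |f.fn v - g.fn v| := by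
  rw [← integral_sub (integrable_moment_smul f.aestronglyMeasurable f.integrable_moment ha hle)
    (integrable_moment_smul g.aestronglyMeasurable g.integrable_moment ha hle)]
  simp_rw [← sub_smul]
  refine norm_integral_smul_le ?_ hle
  refine (f.integrable_moment.sub g.integrable_moment).congr (Eventually.of_forall fun v => ?_)
  simp [mul_sub]

/-- The energy identity `3ρT + ρ|u|² = ∫ |v|² g dv`. -/
theorem VelSpace.energy_eq (g : VelSpace) (hρ : density g.fn ≠ 0) :
    ∫ v, g.fn v * ‖v‖ ^ 2 = 3 * density g.fn * temperature g.fn +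
      density g.fn * ‖bulkVelocity g.fn‖ ^ 2 := by
  set u := bulkVelocity g.fn with hu
  have h0 : Integrable (fun v => g.fn v) := by
    simpa using integrable_moment_smul (a := fun _ => (1 : ℝ)) g.aestronglyMeasurable
      g.integrable_moment continuous_const (fun v => by simp)
  have h1 : Integrable (fun v => g.fn v • v) :=
    integrable_moment_smul g.aestronglyMeasurable g.integrable_moment continuous_id
      norm_le_one_add_sq
  have h2 : Integrable (fun v => g.fn v * ‖v‖ ^ 2) :=
    integrable_moment_smul g.aestronglyMeasurable g.integrable_moment (by fun_prop)
      (fun v => by simp)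
  have hmom : ∫ v, g.fn v • v = density g.fn • u := by
    rw [hu, bulkVelocity, smul_smul, mul_inv_cancel₀ hρ, one_smul]
  have hin : ∫ v, inner ℝ u (g.fn v • v) = density g.fn * ‖u‖ ^ 2 := by
    rw [integral_inner h1, hmom, inner_smul_right, real_inner_self_eq_norm_sq]
  have hT : ∫ v, ‖v - u‖ ^ 2 * g.fn v = 3 * density g.fn * temperature g.fn := by
    rw [temperature, ← hu]; field_simp
  have hexp : ∀ v, ‖v - u‖ ^ 2 * g.fn v =
      g.fn v * ‖v‖ ^ 2 - 2 * inner ℝ u (g.fn v • v) + g.fn v * ‖u‖ ^ 2 := by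
    intro v
    rw [norm_sub_sq_real, inner_smul_right, real_inner_comm]
    ring
  simp_rw [hexp] at hT
  have h3 : Integrable (fun v => 2 * inner ℝ u (g.fn v • v)) := (h1.const_inner u).const_mul 2
  have h4 : Integrable (fun v => g.fn v * ‖v‖ ^ 2 - 2 * inner ℝ u (g.fn v • v)) := h2.sub h3
  rw [integral_add h4 (h0.mul_const _), integral_sub h2 h3, integral_const_mul, hin,
    integral_mul_const] at hT
  change _ - _ + density g.fn * _ = _ at hT
  linarith

/-- The macroscopic fields depend in a Lipschitz way on the moments up to order two. -/
theorem exists_macroscopic_sub_le (M : StructuralConstants) :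
    ∃ K : ℝ, 0 < K ∧ ∀ f g : VelSpace,
      density f.fn ∈ Icc M.ρmin M.ρmax → density g.fn ∈ Icc M.ρmin M.ρmax →
      temperature g.fn ∈ Icc M.Tmin M.Tmax →
      ‖bulkVelocity f.fn‖ ≤ M.umax → ‖bulkVelocity g.fn‖ ≤ M.umax →
      |density f.fn - density g.fn| + ‖bulkVelocity f.fn - bulkVelocity g.fn‖ +
        |temperature f.fn - temperature g.fn| ≤
        K * ∫ v, (1 + ‖v‖ ^ 2) * |f.fn v - g.fn v| := by
  have hTM := M.Tmax_pos
  have hρM := M.ρmax_pos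
  have hρm := M.ρmin_pos
  have hU := M.umax_pos
  set Ku := (1 + M.umax) / M.ρmin with hKu
  have hKu0 : 0 < Ku := by positivity
  set KT := (1 + M.ρmax * (2 * M.umax * Ku) + M.umax ^ 2 + 3 * M.Tmax) / (3 * M.ρmin) with hKT
  have hKT0 : 0 < KT := by positivity
  refine ⟨1 + Ku + KT, by positivity, ?_⟩
  intro f g hρf hρg hTg huf hug
  set D := ∫ v, (1 + ‖v‖ ^ 2) * |f.fn v - g.fn v| with hD
  have hD0 : 0 ≤ D := integral_nonneg fun v => by positivity
  have hρf0 : 0 < density f.fn := hρm.trans_le hρf.1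
  have hρg0 : 0 < density g.fn := hρm.trans_le hρg.1
  have e0 : |density f.fn - density g.fn| ≤ D := by
    simpa [density, hD] using VelSpace.integral_sub_smul f g (a := fun _ => (1 : ℝ))
      continuous_const (fun v => by simp)
  have e1 : ‖density f.fn • bulkVelocity f.fn - density g.fn • bulkVelocity g.fn‖ ≤ D := by
    have := VelSpace.integral_sub_smul f g (a := fun v : Vel => v) continuous_id norm_le_one_add_sq
    rwa [← smul_inv_smul₀ hρf0.ne' (∫ v, f.fn v • v),
      ← smul_inv_smul₀ hρg0.ne' (∫ v, g.fn v • v)] at this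
  have e2 : |(3 * density f.fn * temperature f.fn + density f.fn * ‖bulkVelocity f.fn‖ ^ 2) -
      (3 * density g.fn * temperature g.fn + density g.fn * ‖bulkVelocity g.fn‖ ^ 2)| ≤ D := by
    have := VelSpace.integral_sub_smul f g (a := fun v : Vel => ‖v‖ ^ 2) (by fun_prop)
      (fun v => by simp)
    simp only [smul_eq_mul, Real.norm_eq_abs] at this
    rwa [f.energy_eq hρf0.ne', g.energy_eq hρg0.ne'] at this
  set ρ := density f.fn
  set σ := density g.fn
  set a := bulkVelocity f.fn
  set b := bulkVelocity g.fn
  set S := temperature f.fn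
  set T := temperature g.fn
  have hu : ‖a - b‖ ≤ Ku * D := by
    have h1 : ρ • (a - b) = (ρ • a - σ • b) - (ρ - σ) • b := by
      rw [smul_sub, sub_smul]; abel
    have h2 : ρ * ‖a - b‖ ≤ D + D * M.umax := by
      rw [← Real.norm_of_nonneg hρf0.le, ← norm_smul, h1]
      refine (norm_sub_le _ _).trans (add_le_add e1 ?_)
      rw [norm_smul]
      gcongr
      exact e0
    rw [hKu, div_mul_eq_mul_div, le_div_iff₀ hρm]
    nlinarith [mul_le_mul_of_nonneg_right hρf.1 (norm_nonneg (a - b))]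
  have hT : |S - T| ≤ KT * D := by
    have h1 : 3 * ρ * (S - T) = ((3 * ρ * S + ρ * ‖a‖ ^ 2) - (3 * σ * T + σ * ‖b‖ ^ 2)) -
      (ρ * ((‖a‖ + ‖b‖) * (‖a‖ - ‖b‖)) + (ρ - σ) * ‖b‖ ^ 2) - 3 * (ρ - σ) * T := by ring
    have h2 : |ρ * ((‖a‖ + ‖b‖) * (‖a‖ - ‖b‖))| ≤ M.ρmax * (2 * M.umax * (Ku * D)) := by
      rw [abs_mul, abs_mul, abs_of_pos hρf0, abs_of_nonneg (by positivity : 0 ≤ ‖a‖ + ‖b‖)]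
      gcongr
      · exact hρf.2
      · linarith
      · exact (abs_norm_sub_norm_le _ _).trans hu
    have h3 : |(ρ - σ) * ‖b‖ ^ 2| ≤ D * M.umax ^ 2 := by
      rw [abs_mul, abs_of_nonneg (by positivity : 0 ≤ ‖b‖ ^ 2)]
      gcongr
    have hT0 : 0 ≤ T := M.Tmin_pos.le.trans hTg.1
    have h4 : |3 * (ρ - σ) * T| ≤ 3 * D * M.Tmax := by
      rw [abs_mul, abs_mul, abs_of_pos (M.Tmin_pos.trans_le hTg.1),
        abs_of_pos (by norm_num : (0 : ℝ) < 3)]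
      gcongr
      exact hTg.2
    have h5 : 3 * ρ * |S - T| ≤ D + (M.ρmax * (2 * M.umax * (Ku * D)) + D * M.umax ^ 2) +
        3 * D * M.Tmax := by
      rw [← abs_of_pos (by positivity : 0 < 3 * ρ), ← abs_mul, h1]
      exact (abs_sub _ _).trans (add_le_add ((abs_sub _ _).trans
        (add_le_add e2 ((abs_add_le _ _).trans (add_le_add h2 h3)))) h4)
    rw [hKT, div_mul_eq_mul_div, le_div_iff₀ (by positivity)]
    nlinarith [mul_le_mul_of_nonneg_right hρf.1 (abs_nonneg (S - T))]
  linarith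

theorem exists_isMaxwellianExponent (M : StructuralConstants) :
    ∃ c : ℝ, IsMaxwellianExponent M c := by
  obtain ⟨K, hK, hmax⟩ := exists_abs_maxwellian_sub_le M
  obtain ⟨K', hK', hmac⟩ := exists_macroscopic_sub_le M
  have hTM := M.Tmax_pos
  refine ⟨1 / (8 * M.Tmax), by positivity, K * K', by positivity, ?_⟩
  intro 𝒯 _ f g hf hg z hz v
  refine (hmax _ (hf.density_mem z hz) _ (hg.density_mem z hz) _ (hf.temperature_mem z hz) _
    (hg.temperature_mem z hz) _ _ (hf.bulkVelocity_le z hz) (hg.bulkVelocity_le z hz) v).trans ?_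
  have := hmac (f z) (g z) (hf.density_mem z hz) (hg.density_mem z hz)
    (hg.temperature_mem z hz) (hf.bulkVelocity_le z hz) (hg.bulkVelocity_le z hz)
  calc _ ≤ K * Real.exp (-(1 / (8 * M.Tmax)) * ‖v‖ ^ 2) *
        (K' * ∫ v', (1 + ‖v'‖ ^ 2) * |(f z).fn v' - (g z).fn v'|) := by gcongr
    _ = _ := by ring

/-! ### Integral inequalities -/

/-- No integrability or measurability is needed: the Bochner integral is zero where `h` is not
integrable. -/
theorem ofReal_integral_le_lintegral {α : Type*} [MeasurableSpace α] (μ : Measure α)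
    (h : α → ℝ) : ENNReal.ofReal (∫ x, h x ∂μ) ≤ ∫⁻ x, ENNReal.ofReal (h x) ∂μ := by
  by_cases hh : Integrable h μ
  · rw [integral_eq_lintegral_pos_part_sub_lintegral_neg_part hh]
    exact (ENNReal.ofReal_le_ofReal (sub_le_self _ ENNReal.toReal_nonneg)).trans
      ENNReal.ofReal_toReal_le
  · simp [integral_undef hh]

theorem setIntegral_setIntegral_le_toReal {X Y : Type*} [MeasurableSpace X] [MeasurableSpace Y]
    {μ : Measure X} {ν : Measure Y} {A A' : Set X} {K : Set Y} (hA : A ⊆ A') {h : X → Y → ℝ}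
    {q : X → Y → ℝ≥0∞} (hq : ∫⁻ s in A', ∫⁻ x in K, q s x ∂ν ∂μ ≠ ∞)
    (hle : ∀ᵐ s ∂(μ.restrict A), ∀ᵐ x ∂(ν.restrict K), ENNReal.ofReal (h s x) ≤ q s x) :
    ∫ s in A, ∫ x in K, h s x ∂ν ∂μ ≤ (∫⁻ s in A', ∫⁻ x in K, q s x ∂ν ∂μ).toReal := by
  rw [← ENNReal.ofReal_le_iff_le_toReal hq]
  calc _ ≤ ∫⁻ s in A, ENNReal.ofReal (∫ x in K, h s x ∂ν) ∂μ := ofReal_integral_le_lintegral _ _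
    _ ≤ ∫⁻ s in A, ∫⁻ x in K, q s x ∂ν ∂μ := by
      refine lintegral_mono_ae ?_
      filter_upwards [hle] with s hs
      exact (ofReal_integral_le_lintegral _ _).trans (lintegral_mono_ae hs)
    _ ≤ _ := lintegral_mono_set hA

theorem continuousOn_setIntegral {X Y : Type*} [TopologicalSpace X] [FirstCountableTopology X]
    [TopologicalSpace Y] [T2Space Y] [MeasurableSpace Y] [OpensMeasurableSpace Y]
    {ν : Measure Y} [IsFiniteMeasureOnCompacts ν] {I : Set X} {K : Set Y}
    (hI : IsCompact I) (hK : IsCompact K) [SecondCountableTopology Y] {h : X × Y → ℝ}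
    (hh : ContinuousOn h (I ×ˢ K)) : ContinuousOn (fun s => ∫ x in K, h (s, x) ∂ν) I := by
  obtain ⟨C, hC⟩ := (hI.prod hK).exists_bound_of_continuousOn hh
  refine continuousOn_of_dominated (bound := fun _ => C) ?_ ?_ ?_ ?_
  · intro s hs
    refine ContinuousOn.aestronglyMeasurable ?_ hK.measurableSet
    exact hh.comp (by fun_prop) (fun x hx => ⟨hs, hx⟩)
  · intro s hs
    filter_upwards [ae_restrict_mem hK.measurableSet] with x hx
    exact hC _ ⟨hs, hx⟩
  · exact integrableOn_const hK.measure_lt_top.ne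
  · filter_upwards [ae_restrict_mem hK.measurableSet] with x hx
    exact hh.comp (by fun_prop) (fun s hs => ⟨hs, hx⟩)

/-- Grönwall's inequality in integral form. -/
theorem le_mul_exp_of_le_add_integral {E : ℝ → ℝ} {𝒯 a B : ℝ} (ha : 0 ≤ a)
    (hE : ContinuousOn E (Icc 0 𝒯))
    (h : ∀ t ∈ Icc 0 𝒯, E t ≤ B + a * ∫ s in (0 : ℝ)..t, E s) :
    ∀ t ∈ Icc 0 𝒯, E t ≤ B * Real.exp (a * t) := by
  intro t ht
  have h𝒯 : 0 ≤ 𝒯 := ht.1.trans ht.2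
  set F : ℝ → ℝ := fun t => B + a * ∫ s in (0 : ℝ)..t, E s with hF
  have hint : IntervalIntegrable E volume 0 𝒯 := hE.intervalIntegrable_of_Icc h𝒯
  have hFc : ContinuousOn F (Icc 0 𝒯) := by
    refine continuousOn_const.add (continuousOn_const.mul ?_)
    have := intervalIntegral.continuousOn_primitive_interval (μ := volume) (a := 0) (b := 𝒯)
      (f := E) (by rw [uIcc_of_le h𝒯]; exact hE.integrableOn_Icc)
    rwa [uIcc_of_le h𝒯] at this
  have hFd : ∀ t ∈ Ioo 0 𝒯, HasDerivAt F (a * E t) t := by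
    intro t ht
    refine ((intervalIntegral.integral_hasDerivAt_right ?_ ?_ ?_).const_mul a).const_add B
    · exact hint.mono_set (by
        rw [uIcc_of_le h𝒯, uIcc_of_le ht.1.le]; exact Icc_subset_Icc le_rfl ht.2.le)
    · exact (hE.mono Ioo_subset_Icc_self).stronglyMeasurableAtFilter isOpen_Ioo t ht
    · exact (hE.mono Ioo_subset_Icc_self).continuousAt (isOpen_Ioo.mem_nhds ht)
  -- `F' = aE ≤ aF`, so that `F(t) e^{-at}` is nonincreasing.
  set G : ℝ → ℝ := fun t => F t * Real.exp (-(a * t)) with hG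
  have hGd : ∀ t ∈ Ioo 0 𝒯, HasDerivAt G
      (a * E t * Real.exp (-(a * t)) + F t * (Real.exp (-(a * t)) * -(a * 1))) t := by
    intro t ht
    exact (hFd t ht).mul (((hasDerivAt_id t).const_mul a).neg.exp)
  have hanti : AntitoneOn G (Icc 0 𝒯) := by
    refine antitoneOn_of_deriv_nonpos (convex_Icc _ _) (hFc.mul (by fun_prop)) ?_ ?_
    · rw [interior_Icc]
      exact fun t ht => (hGd t ht).differentiableAt.differentiableWithinAt
    · rw [interior_Icc]
      intro t ht
      rw [(hGd t ht).deriv]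
      have h1 := h t (Ioo_subset_Icc_self ht)
      have h2 := Real.exp_pos (-(a * t))
      have h3 : 0 ≤ a * Real.exp (-(a * t)) * (F t - E t) :=
        mul_nonneg (by positivity) (sub_nonneg.2 h1)
      nlinarith
  have h0 := hanti ⟨le_rfl, h𝒯⟩ ht ht.1
  have h1 : G 0 = B := by simp [hG, hF]
  rw [h1] at h0
  refine (h t ht).trans ?_
  have h2 := mul_le_mul_of_nonneg_right h0 (Real.exp_pos (a * t)).le
  rwa [hG, mul_assoc, ← Real.exp_add, neg_add_cancel, Real.exp_zero, mul_one] at h2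

/-! ### The space-time cylinder -/

theorem isCompact_cube : IsCompact cube := isCompact_Icc

theorem isCompact_timeSpace (𝒯 : ℝ) : IsCompact (timeSpace 𝒯) := isCompact_Icc.prod isCompact_cube

theorem cube_eq_pi : cube = univ.pi fun _ : Fin 3 => Icc (0 : ℝ) 1 := by
  rw [cube, ← pi_univ_Icc]; rfl

theorem uniqueDiffOn_timeSpace {𝒯 : ℝ} (h𝒯 : 0 < 𝒯) : UniqueDiffOn ℝ (timeSpace 𝒯) := by
  refine (uniqueDiffOn_Icc h𝒯).prod ?_
  rw [cube_eq_pi]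
  exact UniqueDiffOn.univ_pi fun _ => uniqueDiffOn_Icc one_pos

/-- The open cube has full measure in `[0,1]³`. -/
theorem ae_restrict_cube_mem_Ioo :
    ∀ᵐ x ∂(volume.restrict cube), ∀ i, x i ∈ Ioo (0 : ℝ) 1 := by
  have h : (univ.pi fun _ : Fin 3 => Ioo (0 : ℝ) 1) =ᵐ[volume] cube := by
    rw [cube]
    exact Measure.univ_pi_Ioo_ae_eq_Icc (f := fun _ => (0 : ℝ)) (g := fun _ => (1 : ℝ))
  rw [← Measure.restrict_congr_set h]
  filter_upwards [ae_restrict_mem (MeasurableSet.univ_pi fun _ => measurableSet_Ioo)] with x hx i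
  exact hx i (mem_univ i)

theorem insertNth_mem_cube {i : Fin 3} {a : ℝ} (ha : a ∈ Icc (0 : ℝ) 1) {y : Fin 2 → ℝ}
    (hy : y ∈ Icc (0 : Fin 2 → ℝ) 1) : (i.insertNth a y : Pos) ∈ cube := by
  rw [cube, Fin.insertNth_mem_Icc]
  exact ⟨ha, hy⟩

theorem continuousOn_face {𝒯 : ℝ} {h : ℝ × Pos → ℝ} (hh : ContinuousOn h (timeSpace 𝒯))
    (i : Fin 3) {a : ℝ} (ha : a ∈ Icc (0 : ℝ) 1) :
    ContinuousOn (fun z : ℝ × (Fin 2 → ℝ) => h (z.1, i.insertNth a z.2))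
      (Icc 0 𝒯 ×ˢ Icc (0 : Fin 2 → ℝ) 1) := by
  refine hh.comp (Continuous.continuousOn ?_) fun z hz => ⟨hz.1, insertNth_mem_cube ha hz.2⟩
  exact continuous_fst.prodMk (Continuous.finInsertNth i continuous_const continuous_snd)

theorem continuousOn_fderivWithin_apply {𝒯 : ℝ} (h𝒯 : 0 < 𝒯) {h : ℝ × Pos → ℝ}
    (hh : ContDiffOn ℝ 1 h (timeSpace 𝒯)) (e : ℝ × Pos) :
    ContinuousOn (fun z => fderivWithin ℝ h (timeSpace 𝒯) z e) (timeSpace 𝒯) :=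
  (hh.continuousOn_fderivWithin (uniqueDiffOn_timeSpace h𝒯) le_rfl).clm_apply continuousOn_const

theorem integral_timeDeriv {𝒯 : ℝ} (h𝒯 : 0 < 𝒯) {φ : ℝ × Pos → ℝ}
    (hφ : ContDiffOn ℝ 1 φ (timeSpace 𝒯)) {t : ℝ} (ht : t ∈ Icc 0 𝒯) {x : Pos} (hx : x ∈ cube) :
    ∫ s in Icc 0 t, fderivWithin ℝ φ (timeSpace 𝒯) (s, x) (1, 0) = φ (t, x) - φ (0, x) := by
  have hsub : Icc 0 t ⊆ Icc 0 𝒯 := Icc_subset_Icc le_rfl ht.2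
  have hmaps : MapsTo (fun s : ℝ => (s, x)) (Icc 0 t) (timeSpace 𝒯) := fun s hs => ⟨hsub hs, hx⟩
  rw [integral_Icc_eq_integral_Ioc, ← intervalIntegral.integral_of_le ht.1]
  refine intervalIntegral.integral_eq_sub_of_hasDerivAt_of_le ht.1
    (f := fun s => φ (s, x)) (hφ.continuousOn.comp (by fun_prop) hmaps) ?_ ?_
  · intro s hs
    have h1 := (hφ.differentiableOn one_ne_zero (s, x)
      (hmaps (Ioo_subset_Icc_self hs))).hasFDerivWithinAt
    have h2 : HasDerivWithinAt (fun s : ℝ => (s, x)) (1, 0) (Icc 0 t) s :=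
      ((hasDerivAt_id s).prodMk (hasDerivAt_const s x)).hasDerivWithinAt
    exact (h1.comp_hasDerivWithinAt s h2 hmaps).hasDerivAt (Icc_mem_nhds hs.1 hs.2)
  · refine ContinuousOn.intervalIntegrable_of_Icc ht.1 ?_
    exact (continuousOn_fderivWithin_apply h𝒯 hφ _).comp (by fun_prop) hmaps

theorem integral_divergence {𝒯 : ℝ} (h𝒯 : 0 < 𝒯) {ψ : Fin 3 → ℝ × Pos → ℝ}
    (hψ : ∀ i, ContDiffOn ℝ 1 (ψ i) (timeSpace 𝒯)) {s : ℝ} (hs : s ∈ Icc 0 𝒯) :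
    ∫ x in cube, ∑ i, fderivWithin ℝ (ψ i) (timeSpace 𝒯) (s, x) (0, Pi.single i 1) =
      ∑ i, ((∫ y in Icc (0 : Fin 2 → ℝ) 1, ψ i (s, i.insertNth (1 : ℝ) y)) -
        ∫ y in Icc (0 : Fin 2 → ℝ) 1, ψ i (s, i.insertNth (0 : ℝ) y)) := by
  have hmaps : MapsTo (fun x : Pos => (s, x)) cube (timeSpace 𝒯) := fun x hx => ⟨hs, hx⟩
  refine integral_divergence_of_hasFDerivAt_off_countable' (a := (0 : Pos)) (b := 1)
    zero_le_one (fun i x => ψ i (s, x))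
    (fun i x => (fderivWithin ℝ (ψ i) (timeSpace 𝒯) (s, x)).comp
      (ContinuousLinearMap.inr ℝ ℝ Pos)) ∅ countable_empty ?_ ?_ ?_
  · exact fun i => (hψ i).continuousOn.comp (by fun_prop) hmaps
  · rintro x ⟨hx, -⟩ i
    have hxc : x ∈ cube := by
      rw [cube_eq_pi]; exact fun i hi => Ioo_subset_Icc_self (hx i hi)
    have h1 := ((hψ i).differentiableOn one_ne_zero (s, x) (hmaps hxc)).hasFDerivWithinAt
    have h2 : HasFDerivWithinAt (fun x : Pos => (s, x)) (ContinuousLinearMap.inr ℝ ℝ Pos) cube x :=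
      (hasFDerivAt_prodMk_right s x).hasFDerivWithinAt
    refine (h1.comp x h2 hmaps).hasFDerivAt ?_
    rw [cube_eq_pi]
    exact set_pi_mem_nhds finite_univ fun i hi => Icc_mem_nhds (hx i hi).1 (hx i hi).2
  · refine ContinuousOn.integrableOn_compact isCompact_cube ?_
    refine continuousOn_finsetSum _ fun i _ => ?_
    exact (continuousOn_fderivWithin_apply h𝒯 (hψ i) _).comp (by fun_prop) hmaps

/-- The balance law for `∂ₜφ + ∑ ∂ᵢψᵢ`, integrated over `[0,t] × [0,1]³`. -/
theorem integral_balance {𝒯 : ℝ} (h𝒯 : 0 < 𝒯) {φ : ℝ × Pos → ℝ} {ψ : Fin 3 → ℝ × Pos → ℝ}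
    (hφ : ContDiffOn ℝ 1 φ (timeSpace 𝒯)) (hψ : ∀ i, ContDiffOn ℝ 1 (ψ i) (timeSpace 𝒯))
    {t : ℝ} (ht : t ∈ Icc 0 𝒯) :
    (∫ x in cube, φ (t, x)) - ∫ x in cube, φ (0, x) =
      ∫ s in Icc 0 t, ((∫ x in cube, (fderivWithin ℝ φ (timeSpace 𝒯) (s, x) (1, 0) +
          ∑ i, fderivWithin ℝ (ψ i) (timeSpace 𝒯) (s, x) (0, Pi.single i 1))) -
        ∑ i, ∫ y in Icc (0 : Fin 2 → ℝ) 1,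
          (ψ i (s, i.insertNth (1 : ℝ) y) - ψ i (s, i.insertNth (0 : ℝ) y))) := by
  have hsub : Icc 0 t ⊆ Icc 0 𝒯 := Icc_subset_Icc le_rfl ht.2
  have hslice : ∀ {h : ℝ × Pos → ℝ}, ContinuousOn h (timeSpace 𝒯) → ∀ s ∈ Icc 0 𝒯,
      IntegrableOn (fun x => h (s, x)) cube := fun hh s hs =>
    ContinuousOn.integrableOn_compact isCompact_cube
      (hh.comp (by fun_prop) (fun x hx => ⟨hs, hx⟩))
  have hface : ∀ i (a : ℝ), a ∈ Icc (0 : ℝ) 1 → ∀ s ∈ Icc 0 𝒯,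
      IntegrableOn (fun y : Fin 2 → ℝ => ψ i (s, i.insertNth a y)) (Icc 0 1) :=
    fun i a ha s hs => ContinuousOn.integrableOn_compact isCompact_Icc
      ((continuousOn_face (hψ i).continuousOn i ha).comp
        (f := fun y : Fin 2 → ℝ => (s, y)) (by fun_prop) (fun y hy => ⟨hs, hy⟩))
  have hdφ := continuousOn_fderivWithin_apply h𝒯 hφ (1, 0)
  rw [← integral_sub (hslice hφ.continuousOn t ht)
    (hslice hφ.continuousOn 0 ⟨le_rfl, h𝒯.le⟩)]
  calc ∫ x in cube, (φ (t, x) - φ (0, x))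
      = ∫ x in cube, ∫ s in Icc 0 t, fderivWithin ℝ φ (timeSpace 𝒯) (s, x) (1, 0) := by
        refine setIntegral_congr_fun isCompact_cube.measurableSet fun x hx => ?_
        exact (integral_timeDeriv h𝒯 hφ ht hx).symm
    _ = ∫ s in Icc 0 t, ∫ x in cube, fderivWithin ℝ φ (timeSpace 𝒯) (s, x) (1, 0) := by
        refine (integral_integral_swap
          (f := fun s x => fderivWithin ℝ φ (timeSpace 𝒯) (s, x) (1, 0)) ?_).symm
        rw [Measure.prod_restrict]
        exact ContinuousOn.integrableOn_compact (isCompact_Icc.prod isCompact_cube)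
          (hdφ.mono (prod_mono hsub le_rfl))
    _ = _ := by
        refine setIntegral_congr_fun measurableSet_Icc fun s hs => ?_
        have hs' := hsub hs
        have h1 : IntegrableOn (fun x => ∑ i,
            fderivWithin ℝ (ψ i) (timeSpace 𝒯) (s, x) (0, Pi.single i 1)) cube :=
          hslice (continuousOn_finsetSum _ fun i _ =>
            continuousOn_fderivWithin_apply h𝒯 (hψ i) _) s hs'
        change _ = _ - _
        rw [integral_add (hslice hdφ s hs') h1, integral_divergence h𝒯 hψ hs']
        simp_rw [fun i => integral_sub (hface i 1 (by simp) s hs') (hface i 0 (by simp) s hs')]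
        ring

/-- An energy method on the cylinder: if `∂ₜφ + ∑ ∂ᵢψᵢ ≤ aφ + τ + q` and the boundary fluxes are
bounded by `η + bᵢ`, then `∫ φ(t)` is bounded in terms of `∫ φ(0)` and the integrals of `τ`, `q`,
`η`, `bᵢ`. The terms `q` and `bᵢ` enter through lower integrals only, so that they need not be
measurable. -/
theorem energy_le {𝒯 : ℝ} (h𝒯 : 0 < 𝒯) {φ τ : ℝ × Pos → ℝ} {ψ : Fin 3 → ℝ × Pos → ℝ}
    (hφ : ContDiffOn ℝ 1 φ (timeSpace 𝒯)) (hψ : ∀ i, ContDiffOn ℝ 1 (ψ i) (timeSpace 𝒯))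
    (hτ : ContinuousOn τ (timeSpace 𝒯)) (hτ0 : ∀ z, 0 ≤ τ z)
    {a η : ℝ} (ha : 0 ≤ a) (hη : 0 ≤ η) {q : ℝ → Pos → ℝ≥0∞}
    {b : Fin 3 → ℝ → (Fin 2 → ℝ) → ℝ≥0∞}
    (hq : ∀ s ∈ Ioo 0 𝒯, ∀ x : Pos, (∀ i, x i ∈ Ioo (0 : ℝ) 1) →
      ENNReal.ofReal (fderivWithin ℝ φ (timeSpace 𝒯) (s, x) (1, 0) +
        ∑ i, fderivWithin ℝ (ψ i) (timeSpace 𝒯) (s, x) (0, Pi.single i 1)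
          - a * φ (s, x) - τ (s, x)) ≤ q s x)
    (hb : ∀ i, ∀ s ∈ Icc 0 𝒯, ∀ y ∈ Icc (0 : Fin 2 → ℝ) 1,
      ENNReal.ofReal (-(ψ i (s, i.insertNth (1 : ℝ) y) - ψ i (s, i.insertNth (0 : ℝ) y)) - η) ≤
        b i s y)
    {t : ℝ} (ht : t ∈ Icc 0 𝒯) :
    ENNReal.ofReal (∫ x in cube, φ (t, x)) ≤ ENNReal.ofReal (Real.exp (a * 𝒯)) *
      (ENNReal.ofReal (∫ x in cube, φ (0, x)) + (∫⁻ s in Icc 0 𝒯, ∫⁻ x in cube, q s x) +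
        ∑ i, (∫⁻ s in Icc 0 𝒯, ∫⁻ y in Icc (0 : Fin 2 → ℝ) 1, b i s y) +
        ENNReal.ofReal (3 * 𝒯 * η) + ENNReal.ofReal (∫ s in Icc 0 𝒯, ∫ x in cube, τ (s, x))) := by
  -- If one of the lower integrals is infinite, so is the right-hand side; otherwise the estimate
  -- is one between real numbers.
  by_cases hQ : (∫⁻ s in Icc 0 𝒯, ∫⁻ x in cube, q s x) = ∞
  · simp [hQ, ENNReal.mul_top, Real.exp_pos]
  by_cases hBi : ∃ i, (∫⁻ s in Icc 0 𝒯, ∫⁻ y in Icc (0 : Fin 2 → ℝ) 1, b i s y) = ∞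
  · have : ∑ i, (∫⁻ s in Icc 0 𝒯, ∫⁻ y in Icc (0 : Fin 2 → ℝ) 1, b i s y) = ∞ := by
      obtain ⟨i, hi⟩ := hBi
      exact ENNReal.sum_eq_top.2 ⟨i, Finset.mem_univ _, hi⟩
    simp [this, ENNReal.mul_top, Real.exp_pos]
  push Not at hBi
  set Q := ∫⁻ s in Icc 0 𝒯, ∫⁻ x in cube, q s x with hQdef
  set β := fun i => ∫⁻ s in Icc 0 𝒯, ∫⁻ y in Icc (0 : Fin 2 → ℝ) 1, b i s y with hβ
  set E : ℝ → ℝ := fun t => ∫ x in cube, φ (t, x) with hE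
  set Θ := ∫ s in Icc 0 𝒯, ∫ x in cube, τ (s, x) with hΘ
  have hEc : ContinuousOn E (Icc 0 𝒯) :=
    continuousOn_setIntegral isCompact_Icc isCompact_cube hφ.continuousOn
  have hτI : ContinuousOn (fun s => ∫ x in cube, τ (s, x)) (Icc 0 𝒯) :=
    continuousOn_setIntegral isCompact_Icc isCompact_cube hτ
  have hΘ0 : 0 ≤ Θ := integral_nonneg fun s => integral_nonneg fun x => hτ0 _
  set D : ℝ × Pos → ℝ := fun z => fderivWithin ℝ φ (timeSpace 𝒯) z (1, 0) +
        ∑ i, fderivWithin ℝ (ψ i) (timeSpace 𝒯) z (0, Pi.single i 1) with hD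
  have hDc : ContinuousOn D (timeSpace 𝒯) :=
    (continuousOn_fderivWithin_apply h𝒯 hφ _).add (continuousOn_finsetSum _ fun i _ =>
            continuousOn_fderivWithin_apply h𝒯 (hψ i) _)
  set J : Fin 3 → ℝ × (Fin 2 → ℝ) → ℝ := fun i z =>
    -(ψ i (z.1, i.insertNth (1 : ℝ) z.2) - ψ i (z.1, i.insertNth (0 : ℝ) z.2)) - η with hJ
  have hJc : ∀ i, ContinuousOn (J i) (Icc 0 𝒯 ×ˢ Icc (0 : Fin 2 → ℝ) 1) := fun i =>
    ((continuousOn_face (hψ i).continuousOn i (by simp)).sub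
      (continuousOn_face (hψ i).continuousOn i (by simp))).neg.sub continuousOn_const
  have hJI : ∀ i, ContinuousOn (fun s => ∫ y in Icc (0 : Fin 2 → ℝ) 1, J i (s, y)) (Icc 0 𝒯) :=
    fun i => continuousOn_setIntegral isCompact_Icc isCompact_Icc (hJc i)
  set H : ℝ × Pos → ℝ := fun z => D z - a * φ z - τ z with hH
  have hHc : ContinuousOn H (timeSpace 𝒯) :=
    (hDc.sub (continuousOn_const.mul hφ.continuousOn)).sub hτ
  have hHI : ContinuousOn (fun s => ∫ x in cube, H (s, x)) (Icc 0 𝒯) :=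
    continuousOn_setIntegral isCompact_Icc isCompact_cube hHc
  have hslice : ∀ {h : ℝ × Pos → ℝ}, ContinuousOn h (timeSpace 𝒯) → ∀ s ∈ Icc 0 𝒯,
      IntegrableOn (fun x => h (s, x)) cube := fun hh s hs =>
    ContinuousOn.integrableOn_compact isCompact_cube
      (hh.comp (by fun_prop) (fun x hx => ⟨hs, hx⟩))
  have hvol : (volume : Measure (Fin 2 → ℝ)).real (Icc 0 1) = 1 := by
    simp [Measure.real, Real.volume_Icc_pi]
  set B := E 0 + Q.toReal + ∑ i, (β i).toReal + 3 * 𝒯 * η + Θ with hB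
  have key : ∀ t ∈ Icc 0 𝒯, E t ≤ B + a * ∫ s in (0 : ℝ)..t, E s := by
    intro t ht
    have hsub : Icc 0 t ⊆ Icc 0 𝒯 := Icc_subset_Icc le_rfl ht.2
    have hbal := integral_balance h𝒯 hφ hψ ht
    have hint : ∀ {h : ℝ → ℝ}, ContinuousOn h (Icc 0 𝒯) → IntegrableOn h (Icc 0 t) := fun hh =>
      (hh.mono hsub).integrableOn_compact isCompact_Icc
    have hrw : ∀ s ∈ Icc 0 t, (∫ x in cube, D (s, x)) - ∑ i, ∫ y in Icc (0 : Fin 2 → ℝ) 1,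
          (ψ i (s, i.insertNth (1 : ℝ) y) - ψ i (s, i.insertNth (0 : ℝ) y)) =
        (∫ x in cube, H (s, x)) + a * E s + (∫ x in cube, τ (s, x)) +
          ∑ i, (∫ y in Icc (0 : Fin 2 → ℝ) 1, J i (s, y)) + 3 * η := by
      intro s hs
      have hs' := hsub hs
      have e1 : ∫ x in cube, H (s, x) =
          (∫ x in cube, D (s, x)) - a * E s - ∫ x in cube, τ (s, x) := by
        have k1 := (hslice hφ.continuousOn s hs').const_mul a
        have k2 : IntegrableOn (fun x => D (s, x) - a * φ (s, x)) cube := (hslice hDc s hs').sub k1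
        rw [hE, ← integral_const_mul, ← integral_sub (hslice hDc s hs') k1, ← integral_sub k2
          (hslice hτ s hs')]
      have e2 : ∀ i, ∫ y in Icc (0 : Fin 2 → ℝ) 1, J i (s, y) =
          -(∫ y in Icc (0 : Fin 2 → ℝ) 1,
          (ψ i (s, i.insertNth (1 : ℝ) y) - ψ i (s, i.insertNth (0 : ℝ) y))) - η := by
        intro i
        have hi : IntegrableOn (fun y : Fin 2 → ℝ =>
            -(ψ i (s, i.insertNth (1 : ℝ) y) - ψ i (s, i.insertNth (0 : ℝ) y))) (Icc 0 1) := by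
          have := (hJc i).comp (f := fun y : Fin 2 → ℝ => (s, y)) (s := Icc 0 1) (by fun_prop)
            (fun y hy => ⟨hs', hy⟩)
          have h2 := (this.add (continuousOn_const (c := η))).integrableOn_compact
            (μ := volume) isCompact_Icc
          refine h2.congr (Eventually.of_forall fun y => ?_)
          simp [hJ]
        rw [hJ]
        change ∫ y in Icc (0 : Fin 2 → ℝ) 1, (_ - η) = _
        rw [integral_sub hi (integrableOn_const isCompact_Icc.measure_lt_top.ne), integral_neg,
          setIntegral_const, hvol, one_smul]
      simp_rw [e1, e2, Finset.sum_sub_distrib, Finset.sum_neg_distrib]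
      simp
      ring
    rw [setIntegral_congr_fun measurableSet_Icc hrw] at hbal
    have i1 := hint hHI
    have i2 := (hint hEc).const_mul a
    have i3 := hint hτI
    have i4 : IntegrableOn (fun s => ∑ i, ∫ y in Icc (0 : Fin 2 → ℝ) 1, J i (s, y)) (Icc 0 t) :=
      integrable_finsetSum _ fun i _ => hint (hJI i)
    have i12 : IntegrableOn (fun s => (∫ x in cube, H (s, x)) + a * E s) (Icc 0 t) := i1.add i2
    have i123 : IntegrableOn (fun s => (∫ x in cube, H (s, x)) + a * E s +
      (∫ x in cube, τ (s, x))) (Icc 0 t) := i12.add i3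
    have i1234 : IntegrableOn (fun s => (∫ x in cube, H (s, x)) + a * E s +
      (∫ x in cube, τ (s, x)) + ∑ i, ∫ y in Icc (0 : Fin 2 → ℝ) 1, J i (s, y)) (Icc 0 t) :=
      i123.add i4
    rw [integral_add i1234 (integrableOn_const measure_Icc_lt_top.ne), integral_add i123 i4,
      integral_add i12 i3, integral_add i1 i2, integral_const_mul,
      integral_finsetSum _ fun i _ => hint (hJI i), setIntegral_const] at hbal
    have j1 : ∫ s in Icc 0 t, ∫ x in cube, H (s, x) ≤ Q.toReal := by
      refine setIntegral_setIntegral_le_toReal hsub hQ ?_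
      rw [← Measure.restrict_congr_set Ioo_ae_eq_Icc]
      filter_upwards [ae_restrict_mem measurableSet_Ioo] with s hs
      filter_upwards [ae_restrict_cube_mem_Ioo] with x hx
      exact hq s ⟨hs.1, hs.2.trans_le ht.2⟩ x hx
    have j3 : ∫ s in Icc 0 t, ∫ x in cube, τ (s, x) ≤ Θ :=
      setIntegral_mono_set (hτI.integrableOn_compact isCompact_Icc)
        (Eventually.of_forall fun s => integral_nonneg fun x => hτ0 _) hsub.eventuallyLE
    have j4 : ∑ i, ∫ s in Icc 0 t, ∫ y in Icc (0 : Fin 2 → ℝ) 1, J i (s, y) ≤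
        ∑ i, (β i).toReal := by
      refine Finset.sum_le_sum fun i _ => setIntegral_setIntegral_le_toReal hsub (hBi i) ?_
      filter_upwards [ae_restrict_mem measurableSet_Icc] with s hs
      filter_upwards [ae_restrict_mem measurableSet_Icc] with y hy
      exact hb i s (hsub hs) y hy
    have j5 : (volume : Measure ℝ).real (Icc 0 t) • (3 * η) ≤ 3 * 𝒯 * η := by
      have : (volume : Measure ℝ).real (Icc 0 t) = t := by simp [Measure.real, ht.1]
      rw [this, smul_eq_mul]
      nlinarith [mul_le_mul_of_nonneg_right ht.2 hη]
    rw [intervalIntegral.integral_of_le ht.1, ← integral_Icc_eq_integral_Ioc]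
    change E t - E 0 = _ at hbal
    rw [hB]
    linarith
  have hE0 : E 0 ≤ (ENNReal.ofReal (E 0)).toReal := by
    rw [ENNReal.toReal_ofReal']; exact le_max_left _ _
  have hfin := le_mul_exp_of_le_add_integral ha hEc key t ht
  have hβt : ∀ i, β i ≠ ∞ := hBi
  have hS : ∑ i, β i ≠ ∞ := ENNReal.sum_ne_top.2 fun i _ => hβt i
  have h3 : 0 ≤ 3 * 𝒯 * η := by positivity
  set Y := ENNReal.ofReal (E 0) + Q + ∑ i, β i + ENNReal.ofReal (3 * 𝒯 * η) + ENNReal.ofReal Θ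
    with hY
  have hYtop : Y ≠ ∞ := by simp [hY, hQ, hβt]
  have hBY : B ≤ Y.toReal := by
    rw [hY, ENNReal.toReal_add (by simp [hQ, hβt]) (by simp), ENNReal.toReal_add
      (by simp [hQ, hβt]) (by simp), ENNReal.toReal_add (by simp [hQ]) hS,
      ENNReal.toReal_add (by simp) hQ, ENNReal.toReal_sum fun i _ => hBi i,
      ENNReal.toReal_ofReal h3, ENNReal.toReal_ofReal hΘ0, hB]
    linarith
  calc ENNReal.ofReal (E t) ≤ ENNReal.ofReal (Real.exp (a * 𝒯) * Y.toReal) := by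
        refine ENNReal.ofReal_le_ofReal (hfin.trans ?_)
        rw [mul_comm]
        have : Real.exp (a * t) ≤ Real.exp (a * 𝒯) := by
          have := ht.2
          gcongr
        calc Real.exp (a * t) * B ≤ Real.exp (a * t) * Y.toReal := by gcongr
          _ ≤ _ := by gcongr
    _ = _ := by rw [ENNReal.ofReal_mul (Real.exp_pos _).le, ENNReal.ofReal_toReal hYtop]

/-! ### Weighted quadratic forms on `L²(ℝ³)` -/

/-- The inclusion of `L¹₂ ∩ L²` into `L²`. -/
def VelSpace.toL2 : VelSpace →L[ℝ] Lp ℝ 2 (volume : Measure Vel) :=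
  (ContinuousLinearMap.snd ℝ _ _).comp velSubmodule.subtypeL

/-- The inclusion of `L¹₂ ∩ L²` into `L¹₂`. -/
def VelSpace.toL1 : VelSpace →L[ℝ] Lp ℝ 1 momentMeasure :=
  (ContinuousLinearMap.fst ℝ _ _).comp velSubmodule.subtypeL

theorem VelSpace.coe_toL2 (g : VelSpace) : (VelSpace.toL2 g : Vel → ℝ) = g.fn := rfl

theorem VelSpace.fn_sub (f g : VelSpace) :
    (f - g).fn =ᵐ[volume] fun v => f.fn v - g.fn v := Lp.coeFn_sub f.1.2 g.1.2

/-- The bilinear form `(g, h) ↦ ∫ m g h dv` on `L²` given by a bounded multiplier `m`. -/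
def multiplierForm {m : Vel → ℝ} (hm : MemLp m ∞ volume) :
    Lp ℝ 2 (volume : Measure Vel) →L[ℝ] Lp ℝ 2 (volume : Measure Vel) →L[ℝ] ℝ :=
  ((ContinuousLinearMap.mul ℝ ℝ).lpPairing volume 2 2).comp
    ((ContinuousLinearMap.mul ℝ ℝ).holderL volume ∞ 2 2 (hm.toLp m))

theorem multiplierForm_apply {m : Vel → ℝ} (hm : MemLp m ∞ volume)
    (g h : Lp ℝ 2 (volume : Measure Vel)) : multiplierForm hm g h = ∫ v, m v * g v * h v := by
  change (ContinuousLinearMap.mul ℝ ℝ).lpPairing volume 2 2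
    ((ContinuousLinearMap.mul ℝ ℝ).holder 2 (hm.toLp m) g) h = _
  rw [ContinuousLinearMap.lpPairing_eq_integral]
  refine integral_congr_ae ?_
  filter_upwards [(ContinuousLinearMap.mul ℝ ℝ).coeFn_holder (r := 2) (hm.toLp m) g,
    hm.coeFn_toLp] with v h1 h2
  rw [h1, h2]
  rfl

theorem multiplierForm_comm {m : Vel → ℝ} (hm : MemLp m ∞ volume)
    (g h : Lp ℝ 2 (volume : Measure Vel)) : multiplierForm hm g h = multiplierForm hm h g := by
  simp_rw [multiplierForm_apply, mul_right_comm]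

theorem integrable_multiplier {m : Vel → ℝ} (hm : MemLp m ∞ volume) (g h : VelSpace) :
    Integrable (fun v => m v * g.fn v * h.fn v) := by
  have h1 : MemLp (fun v => m v * g.fn v) 2 volume := g.memLp.mul' hm
  exact h1.integrable_mul h.memLp

/-- The quadratic form `∫ m R² dv` along a map `R` with values in `L¹₂ ∩ L²`. -/
def quadForm (m : Vel → ℝ) (R : ℝ × Pos → VelSpace) (z : ℝ × Pos) : ℝ :=
  ∫ v, m v * (R z).fn v * (R z).fn v

theorem quadForm_eq {m : Vel → ℝ} (hm : MemLp m ∞ volume) (R : ℝ × Pos → VelSpace) :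
    quadForm m R = fun z => multiplierForm hm (VelSpace.toL2 (R z)) (VelSpace.toL2 (R z)) := by
  funext z
  rw [multiplierForm_apply]
  rfl

theorem contDiffOn_quadForm {m : Vel → ℝ} (hm : MemLp m ∞ volume) {R : ℝ × Pos → VelSpace}
    {A : Set (ℝ × Pos)} (hR : ContDiffOn ℝ 1 R A) : ContDiffOn ℝ 1 (quadForm m R) A := by
  rw [quadForm_eq hm]
  have h := VelSpace.toL2.contDiff.comp_contDiffOn hR
  exact ((multiplierForm hm).contDiff.comp_contDiffOn h).clm_apply h

theorem fderivWithin_bilin_self {X E F : Type*} [NormedAddCommGroup X] [NormedSpace ℝ X]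
    [NormedAddCommGroup E] [NormedSpace ℝ E] [NormedAddCommGroup F] [NormedSpace ℝ F]
    (B : F →L[ℝ] F →L[ℝ] ℝ) (hB : ∀ g h, B g h = B h g) (T : E →L[ℝ] F) {R : X → E} {A : Set X}
    {z : X} (hR : DifferentiableWithinAt ℝ R A z) (hA : UniqueDiffWithinAt ℝ A z) (e : X) :
    fderivWithin ℝ (fun z => B (T (R z)) (T (R z))) A z e =
      2 * B (T (R z)) (T (fderivWithin ℝ R A z e)) := by
  have h := T.hasFDerivAt.comp_hasFDerivWithinAt z hR.hasFDerivWithinAt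
  have h3 := (B.hasFDerivWithinAt_of_bilinear h h).fderivWithin hA
  simp only [Function.comp_def] at h3
  rw [h3]
  simp only [add_apply, ContinuousLinearMap.precompR_apply,
    ContinuousLinearMap.precompL_apply, ContinuousLinearMap.comp_apply]
  rw [hB _ (T (R z)), two_mul]
  rfl

theorem fderivWithin_quadForm {m : Vel → ℝ} (hm : MemLp m ∞ volume) {R : ℝ × Pos → VelSpace}
    {A : Set (ℝ × Pos)} {z : ℝ × Pos} (hR : DifferentiableWithinAt ℝ R A z)
    (hA : UniqueDiffWithinAt ℝ A z) (e : ℝ × Pos) :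
    fderivWithin ℝ (quadForm m R) A z e =
      ∫ v, 2 * (m v * (R z).fn v * (fderivWithin ℝ R A z e).fn v) := by
  rw [quadForm_eq hm, fderivWithin_bilin_self _ (multiplierForm_comm hm) _ hR hA,
    integral_const_mul, multiplierForm_apply]
  simp_rw [VelSpace.coe_toL2]

/-! ### Truncated weights -/

/-- The set on which both the velocity and the weight are at most `n`. -/
def truncSet (w : Vel → ℝ) (n : ℕ) : Set Vel := {v | ‖v‖ ≤ n ∧ w v ≤ n}

/-- The weight `w`, cut off outside `truncSet w n`. -/
def truncWeight (w : Vel → ℝ) (n : ℕ) : Vel → ℝ := (truncSet w n).indicator w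

section trunc

variable {w : Vel → ℝ}

theorem measurableSet_truncSet (hw : Measurable w) (n : ℕ) : MeasurableSet (truncSet w n) :=
  (measurableSet_le measurable_norm measurable_const).inter
    (measurableSet_le hw measurable_const)

theorem truncSet_mono {n k : ℕ} (h : n ≤ k) : truncSet w n ⊆ truncSet w k := by
  have h' : (n : ℝ) ≤ k := by exact_mod_cast h
  exact fun v hv => ⟨hv.1.trans h', hv.2.trans h'⟩

theorem eventually_mem_truncSet (w : Vel → ℝ) (v : Vel) : ∀ᶠ n in atTop, v ∈ truncSet w n := by
  obtain ⟨k, hk⟩ := exists_nat_ge (max ‖v‖ (w v))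
  filter_upwards [eventually_ge_atTop k] with n hn
  exact truncSet_mono hn ⟨(le_max_left _ _).trans hk, (le_max_right _ _).trans hk⟩

theorem measurable_truncWeight (hw : Measurable w) (n : ℕ) : Measurable (truncWeight w n) :=
  hw.indicator (measurableSet_truncSet hw n)

theorem truncWeight_nonneg (h1 : ∀ v, 1 ≤ w v) (n : ℕ) (v : Vel) : 0 ≤ truncWeight w n v :=
  indicator_nonneg (fun v _ => zero_le_one.trans (h1 v)) v

theorem truncWeight_le (h1 : ∀ v, 1 ≤ w v) (n : ℕ) (v : Vel) : truncWeight w n v ≤ w v :=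
  indicator_le_self' (fun v _ => zero_le_one.trans (h1 v)) v

theorem truncWeight_le_nat (n : ℕ) (v : Vel) : truncWeight w n v ≤ n := by
  rw [truncWeight]
  by_cases hv : v ∈ truncSet w n
  · rw [indicator_of_mem hv]; exact hv.2
  · rw [indicator_of_notMem hv]; positivity

theorem memLp_truncWeight_sq (hw : Measurable w) (h1 : ∀ v, 1 ≤ w v) (n : ℕ) :
    MemLp (fun v => truncWeight w n v ^ 2) ∞ volume := by
  refine memLp_top_of_bound ((measurable_truncWeight hw n).pow_const 2).aestronglyMeasurable
    ((n : ℝ) ^ 2) (Eventually.of_forall fun v => ?_)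
  rw [Real.norm_of_nonneg (by positivity)]
  have := truncWeight_nonneg h1 n v
  gcongr
  exact truncWeight_le_nat n v

theorem abs_coord_le_norm (v : Vel) (i : Fin 3) : |v i| ≤ ‖v‖ := by
  simpa using PiLp.norm_apply_le v i

theorem memLp_coord_mul_truncWeight_sq (hw : Measurable w) (h1 : ∀ v, 1 ≤ w v) (n : ℕ)
    (i : Fin 3) : MemLp (fun v => v i * truncWeight w n v ^ 2) ∞ volume := by
  have hm : Measurable fun v : Vel => v i := by fun_prop
  refine memLp_top_of_bound
    (hm.mul ((measurable_truncWeight hw n).pow_const 2)).aestronglyMeasurable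
    ((n : ℝ) * (n : ℝ) ^ 2) (Eventually.of_forall fun v => ?_)
  by_cases hv : v ∈ truncSet w n
  · rw [norm_mul, norm_pow, Real.norm_eq_abs, Real.norm_of_nonneg (truncWeight_nonneg h1 n v)]
    have := truncWeight_nonneg h1 n v
    have h2 := truncWeight_le_nat (w := w) n v
    have h3 := (abs_coord_le_norm v i).trans hv.1
    gcongr
  · rw [truncWeight, indicator_of_notMem hv]
    simp
    positivity

/-- The part `∫ (1+|v|²)|g| dv` of the `L¹₂` norm that is carried by the complement of
`truncSet w n`. -/
def tail (w : Vel → ℝ) (n : ℕ) (g : VelSpace) : ℝ :=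
  ‖LpToLpRestrictCLM Vel ℝ ℝ momentMeasure 1 (truncSet w n)ᶜ (VelSpace.toL1 g)‖

theorem continuous_tail (n : ℕ) : Continuous (tail w n) := by
  unfold tail
  fun_prop

theorem tail_nonneg (n : ℕ) (g : VelSpace) : 0 ≤ tail w n g := norm_nonneg _

theorem integrable_moment_abs (g : VelSpace) :
    Integrable (fun v => (1 + ‖v‖ ^ 2) * |g.fn v|) := by
  refine g.integrable_moment.abs.congr (Eventually.of_forall fun v => ?_)
  simp only
  rw [abs_mul, abs_of_pos (by positivity : 0 < 1 + ‖v‖ ^ 2)]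

theorem tail_eq (hw : Measurable w) (n : ℕ) (g : VelSpace) :
    tail w n g = ∫ v in (truncSet w n)ᶜ, (1 + ‖v‖ ^ 2) * |g.fn v| := by
  have hS := (measurableSet_truncSet hw n).compl
  rw [tail, L1.norm_eq_integral_norm]
  have h1 : (fun v => ‖LpToLpRestrictCLM Vel ℝ ℝ momentMeasure 1 (truncSet w n)ᶜ
      (VelSpace.toL1 g) v‖) =ᵐ[momentMeasure.restrict (truncSet w n)ᶜ] fun v => |g.fn v| := by
    filter_upwards [LpToLpRestrictCLM_coeFn ℝ (μ := momentMeasure) (truncSet w n)ᶜ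
      (VelSpace.toL1 g), ae_restrict_of_ae (momentMeasure_ac.ae_le g.fst_ae_eq)] with v h2 h3
    rw [h2, Real.norm_eq_abs, ← h3]
    rfl
  rw [integral_congr_ae h1, momentMeasure,
    setIntegral_withDensity_eq_setIntegral_toReal_smul (by fun_prop)
      (Eventually.of_forall fun _ => ENNReal.ofReal_lt_top) _ hS]
  refine integral_congr_ae (Eventually.of_forall fun v => ?_)
  simp [ENNReal.toReal_ofReal (by positivity : 0 ≤ 1 + ‖v‖ ^ 2)]

theorem tendsto_tail (hw : Measurable w) (g : VelSpace) :
    Tendsto (fun n => tail w n g) atTop (𝓝 0) := by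
  simp_rw [tail_eq hw]
  have h := tendsto_setIntegral_of_antitone (μ := volume) (s := fun n => (truncSet w n)ᶜ)
    (f := fun v => (1 + ‖v‖ ^ 2) * |g.fn v|)
    (fun n => (measurableSet_truncSet hw n).compl)
    (fun n k hnk => compl_subset_compl.2 (truncSet_mono hnk))
    ⟨0, (integrable_moment_abs g).integrableOn⟩
  have he : ⋂ n, (truncSet w n)ᶜ = ∅ := by
    rw [← compl_iUnion, compl_empty_iff, eq_univ_iff_forall]
    exact fun v => mem_iUnion.2 (eventually_mem_truncSet w v).exists
  rwa [he, setIntegral_empty] at h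

/-- A bound of the tails that is uniform in `n`. -/
theorem tail_le (hw : Measurable w) (n : ℕ) (g : VelSpace) : tail w n g ≤ tail w 0 g := by
  rw [tail_eq hw, tail_eq hw]
  exact setIntegral_mono_set (integrable_moment_abs g).integrableOn
    (Eventually.of_forall fun v => by positivity)
    (compl_subset_compl.2 (truncSet_mono n.zero_le)).eventuallyLE

theorem sq_integral_mul_le {α : Type*} [MeasurableSpace α] {μ : Measure α} {p q : α → ℝ}
    (hp : MemLp p 2 μ) (hq : MemLp q 2 μ) :
    (∫ x, |p x| * |q x| ∂μ) ^ 2 ≤ (∫ x, p x ^ 2 ∂μ) * ∫ x, q x ^ 2 ∂μ := by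
  have h := integral_mul_le_Lp_mul_Lq_of_nonneg (μ := μ) Real.HolderConjugate.two_two
    (f := fun x => |p x|) (g := fun x => |q x|)
    (Eventually.of_forall fun _ => abs_nonneg _) (Eventually.of_forall fun _ => abs_nonneg _)
    (by rw [ENNReal.ofReal_ofNat]; exact hp.abs) (by rw [ENNReal.ofReal_ofNat]; exact hq.abs)
  simp only [Real.rpow_two, sq_abs, ← Real.sqrt_eq_rpow] at h
  have hP : 0 ≤ ∫ x, p x ^ 2 ∂μ := integral_nonneg fun _ => sq_nonneg _
  have hQ : 0 ≤ ∫ x, q x ^ 2 ∂μ := integral_nonneg fun _ => sq_nonneg _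
  calc _ ≤ (√(∫ x, p x ^ 2 ∂μ) * √(∫ x, q x ^ 2 ∂μ)) ^ 2 :=
        pow_le_pow_left₀ (integral_nonneg fun _ => by positivity) h 2
    _ = _ := by rw [mul_pow, Real.sq_sqrt hP, Real.sq_sqrt hQ]

/-- The `L¹₂` norm is controlled by the truncated weighted `L²` norm, up to the tail. This is
where the integrability of `(1+|v|²)²/w²` enters. -/
theorem sq_moment_le (hw : Measurable w) (h1 : ∀ v, 1 ≤ w v)
    (hinv : Integrable (fun v : Vel => (1 + ‖v‖ ^ 2) ^ 2 / w v ^ 2)) (n : ℕ) (g : VelSpace) :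
    (∫ v, (1 + ‖v‖ ^ 2) * |g.fn v|) ^ 2 ≤
      2 * (∫ v, (1 + ‖v‖ ^ 2) ^ 2 / w v ^ 2) * (∫ v, truncWeight w n v ^ 2 * g.fn v * g.fn v) +
        2 * tail w n g ^ 2 := by
  have hS := measurableSet_truncSet hw n
  have hsplit := integral_add_compl hS (integrable_moment_abs g)
  rw [← tail_eq hw] at hsplit
  set I := ∫ v in truncSet w n, (1 + ‖v‖ ^ 2) * |g.fn v| with hI
  have hp : MemLp (fun v : Vel => (1 + ‖v‖ ^ 2) / w v) 2 volume := by
    rw [memLp_two_iff_integrable_sq]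
    · simpa [div_pow] using hinv
    · exact ((by fun_prop : Measurable fun v : Vel => 1 + ‖v‖ ^ 2).div hw).aestronglyMeasurable
  have hb : MemLp (truncWeight w n) ∞ volume := by
    refine memLp_top_of_bound (measurable_truncWeight hw n).aestronglyMeasurable (n : ℝ)
      (Eventually.of_forall fun v => ?_)
    rw [Real.norm_of_nonneg (truncWeight_nonneg h1 n v)]
    exact truncWeight_le_nat n v
  have hq : MemLp (fun v => truncWeight w n v * g.fn v) 2 volume := g.memLp.mul' hb
  have hIle : I = ∫ v, |(1 + ‖v‖ ^ 2) / w v| * |truncWeight w n v * g.fn v| := by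
    rw [hI, ← integral_indicator hS]
    refine integral_congr_ae (Eventually.of_forall fun v => ?_)
    have hwv : 0 < w v := zero_lt_one.trans_le (h1 v)
    by_cases hv : v ∈ truncSet w n
    · simp only [truncWeight, indicator_of_mem hv]
      rw [abs_mul, abs_of_pos hwv, abs_of_pos (by positivity : 0 < (1 + ‖v‖ ^ 2) / w v)]
      field_simp
    · simp only [truncWeight, indicator_of_notMem hv]
      simp
  have hCS := sq_integral_mul_le hp hq
  rw [← hIle] at hCS
  have e1 : ∫ v : Vel, ((1 + ‖v‖ ^ 2) / w v) ^ 2 = ∫ v, (1 + ‖v‖ ^ 2) ^ 2 / w v ^ 2 := by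
    simp_rw [div_pow]
  have e2 : ∫ v, (truncWeight w n v * g.fn v) ^ 2 =
      ∫ v, truncWeight w n v ^ 2 * g.fn v * g.fn v := by
    congr 1; funext v; ring
  rw [e1, e2] at hCS
  rw [← hsplit]
  nlinarith [sq_nonneg (I - tail w n g)]

end trunc

/-! ### Bounds for the source and the boundary flux -/

theorem ofReal_sq_eq_enorm_sq (p : ℝ) : ENNReal.ofReal (p ^ 2) = ‖p‖ₑ ^ 2 := by
  rw [← sq_abs, ENNReal.ofReal_pow (abs_nonneg p), ← Real.enorm_eq_ofReal_abs]

/-- The function `q` need not be measurable. -/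
theorem ofReal_sub_integral_le {p k : Vel → ℝ} {q : Vel → ℝ≥0∞} {C : ℝ} (hp : Integrable p)
    (hk : Integrable k) (hC : ∫ v, k v ≤ C) (h : ∀ᵐ v, ENNReal.ofReal (p v - k v) ≤ q v) :
    ENNReal.ofReal ((∫ v, p v) - C) ≤ ∫⁻ v, q v :=
  calc _ ≤ ENNReal.ofReal (∫ v, (p v - k v)) := by
        rw [integral_sub hp hk]; exact ENNReal.ofReal_le_ofReal (by linarith)
    _ ≤ ∫⁻ v, ENNReal.ofReal (p v - k v) := ofReal_integral_le_lintegral _ _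
    _ ≤ _ := lintegral_mono_ae h

theorem ae_fn_fderivWithin_sub {𝒯 : ℝ} (h𝒯 : 0 < 𝒯) {f g : ℝ × Pos → VelSpace}
    (hf : ContDiffOn ℝ 1 f (timeSpace 𝒯)) (hg : ContDiffOn ℝ 1 g (timeSpace 𝒯))
    {z : ℝ × Pos} (hz : z ∈ timeSpace 𝒯) (e : ℝ × Pos) :
    (fderivWithin ℝ (fun z => f z - g z) (timeSpace 𝒯) z e).fn =ᵐ[volume] fun v =>
      (fderivWithin ℝ f (timeSpace 𝒯) z e).fn v - (fderivWithin ℝ g (timeSpace 𝒯) z e).fn v := by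
  rw [fderivWithin_fun_sub (uniqueDiffOn_timeSpace h𝒯 z hz) (hf.differentiableOn one_ne_zero z hz)
    (hg.differentiableOn one_ne_zero z hz)]
  exact VelSpace.fn_sub _ _

/-- The elementary inequality behind the energy estimate: here `ω` is the truncated weight, `r` the
difference of the solution and its approximation, `d` that of the Maxwellians, `P` the residual,
and `δ` a bound for `ω d / Kn`. -/
theorem source_le {ω W r d P κ δ : ℝ} (hω : 0 ≤ ω) (hωW : ω ≤ W) (hκ : 0 ≤ κ)
    (hd : κ * (ω * |d|) ≤ δ) :
    2 * (ω ^ 2 * r * (κ * (d - r) - P)) - (2 * (ω ^ 2 * r * r) + δ ^ 2) ≤ (W * P) ^ 2 := by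
  have h1 : 2 * (ω * r) * (κ * (ω * d)) ≤ (ω * r) ^ 2 + (κ * (ω * d)) ^ 2 :=
    two_mul_le_add_sq _ _
  have h2 : (κ * (ω * d)) ^ 2 ≤ δ ^ 2 := by
    rw [← sq_abs, abs_mul, abs_mul, abs_of_nonneg hω, abs_of_nonneg hκ]
    gcongr
  have h3 : -(2 * (ω * r) * (ω * P)) ≤ (ω * r) ^ 2 + (ω * P) ^ 2 := by
    nlinarith [sq_nonneg (ω * r + ω * P)]
  have h4 : (ω * P) ^ 2 ≤ (W * P) ^ 2 := by
    rw [mul_pow, mul_pow]; gcongr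
  have h5 : 0 ≤ κ * (ω * r) ^ 2 := by positivity
  nlinarith

/-- The source term in the balance law for the truncated weighted energy of `f - g`, where `f`
satisfies the equation at `z`, is bounded by the energy, the tail and the residual of `g`. -/
theorem source_term_le {𝒯 Kn c L : ℝ} (h𝒯 : 0 < 𝒯) (hKn : 0 < Kn) (hL : 0 < L) {w : Vel → ℝ}
    (hw : Measurable w) (hwa : IsAdmissibleWeight c w) {f g : ℝ × Pos → VelSpace}
    (hf : ContDiffOn ℝ 1 f (timeSpace 𝒯)) (hg : ContDiffOn ℝ 1 g (timeSpace 𝒯)) {s : ℝ} {x : Pos}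
    (hz : (s, x) ∈ timeSpace 𝒯)
    (hM : ∀ v, |localMaxwellian (f (s, x)).fn v - localMaxwellian (g (s, x)).fn v| ≤
        L * Real.exp (-c * ‖v‖ ^ 2) *
          ∫ v', (1 + ‖v'‖ ^ 2) * |(f (s, x)).fn v' - (g (s, x)).fn v'|)
    (heq : ∀ᵐ v, transport 𝒯 f s x v = relaxation Kn f s x v) (n : ℕ) {β : ℝ}
    (hβ : β = 2 * ((L / Kn) ^ 2 * ∫ v, w v ^ 2 * Real.exp (-2 * c * ‖v‖ ^ 2))) :
    ENNReal.ofReal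
      (fderivWithin ℝ (quadForm (fun v => truncWeight w n v ^ 2) (fun z => f z - g z))
          (timeSpace 𝒯) (s, x) (1, 0) +
        ∑ i : Fin 3, fderivWithin ℝ
          (quadForm (fun v => v i * truncWeight w n v ^ 2) (fun z => f z - g z))
          (timeSpace 𝒯) (s, x) (0, Pi.single i 1)
        - (2 + β * ∫ v, (1 + ‖v‖ ^ 2) ^ 2 / w v ^ 2) *
          quadForm (fun v => truncWeight w n v ^ 2) (fun z => f z - g z) (s, x)
        - β * tail w n (f (s, x) - g (s, x)) ^ 2) ≤
      ∫⁻ v, ‖w v * (transport 𝒯 g s x v - relaxation Kn g s x v)‖ₑ ^ 2 := by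
  have hU := uniqueDiffOn_timeSpace h𝒯 (s, x) hz
  have hR : DifferentiableWithinAt ℝ (fun z => f z - g z) (timeSpace 𝒯) (s, x) :=
    (hf.differentiableOn one_ne_zero _ hz).sub (hg.differentiableOn one_ne_zero _ hz)
  have m0 := memLp_truncWeight_sq hw hwa.one_le n
  have mi := memLp_coord_mul_truncWeight_sq hw hwa.one_le n
  set R := fun z => f z - g z with hRdef
  set DR := fderivWithin ℝ R (timeSpace 𝒯) (s, x) with hDR
  set r := (R (s, x)).fn with hr
  set ω := truncWeight w n with hω
  set G := ∫ v, w v ^ 2 * Real.exp (-2 * c * ‖v‖ ^ 2) with hG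
  set K := ∫ v : Vel, (1 + ‖v‖ ^ 2) ^ 2 / w v ^ 2 with hK
  set m := ∫ v', (1 + ‖v'‖ ^ 2) * |(f (s, x)).fn v' - (g (s, x)).fn v'| with hm
  have hG0 : 0 ≤ G := integral_nonneg fun v => by positivity
  have hrfg := VelSpace.fn_sub (f (s, x)) (g (s, x))
  have hm' : m = ∫ v, (1 + ‖v‖ ^ 2) * |r v| := by
    rw [hm]
    refine integral_congr_ae ?_
    filter_upwards [hrfg] with v hv
    simp only [hr, hRdef, hv]
  have hm2 : m ^ 2 ≤
      2 * K * quadForm (fun v => ω v ^ 2) R (s, x) + 2 * tail w n (R (s, x)) ^ 2 := by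
    rw [hm']
    exact sq_moment_le hw hwa.one_le hwa.integrable_inv n (R (s, x))
  rw [fderivWithin_quadForm m0 hR hU]
  simp_rw [fun i => fderivWithin_quadForm (mi i) hR hU (0, Pi.single i 1)]
  have I0 : Integrable (fun v => 2 * (ω v ^ 2 * r v * (DR (1, 0)).fn v)) :=
    (integrable_multiplier m0 _ _).const_mul 2
  have Ii : ∀ i : Fin 3,
      Integrable (fun v => 2 * (v i * ω v ^ 2 * r v * (DR (0, Pi.single i 1)).fn v)) :=
    fun i => (integrable_multiplier (mi i) _ _).const_mul 2
  have Is : Integrable (fun v => ∑ i : Fin 3,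
      2 * (v i * ω v ^ 2 * r v * (DR (0, Pi.single i 1)).fn v)) :=
    integrable_finsetSum _ fun i _ => Ii i
  rw [← integral_finsetSum _ fun i _ => Ii i, ← integral_add I0 Is, sub_sub]
  have J1 : Integrable (fun v => 2 * (ω v ^ 2 * r v * r v)) :=
    (integrable_multiplier m0 _ _).const_mul 2
  have J2 : Integrable (fun v => (L * m / Kn) ^ 2 * (w v ^ 2 * Real.exp (-2 * c * ‖v‖ ^ 2))) :=
    hwa.integrable_gauss.const_mul _
  refine ofReal_sub_integral_le
    (k := fun v => 2 * (ω v ^ 2 * r v * r v) +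
      (L * m / Kn) ^ 2 * (w v ^ 2 * Real.exp (-2 * c * ‖v‖ ^ 2)))
    (I0.add Is) (J1.add J2) ?_ ?_
  · rw [integral_add J1 J2, integral_const_mul, integral_const_mul]
    change 2 * quadForm (fun v => ω v ^ 2) R (s, x) + _ ≤ _
    have h1 : (L * m / Kn) ^ 2 * G = (L / Kn) ^ 2 * G * m ^ 2 := by ring
    have h2 : (L / Kn) ^ 2 * G * m ^ 2 ≤ (L / Kn) ^ 2 * G *
        (2 * K * quadForm (fun v => ω v ^ 2) R (s, x) + 2 * tail w n (R (s, x)) ^ 2) := by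
      gcongr
    rw [h1, hβ]
    linarith
  · have ht := ae_fn_fderivWithin_sub h𝒯 hf hg hz (1, 0)
    have hx := fun i : Fin 3 => ae_fn_fderivWithin_sub h𝒯 hf hg hz (0, Pi.single i 1)
    filter_upwards [heq, hrfg, ht, ae_all_iff.2 hx] with v h1 h2 h3 h4
    rw [← ofReal_sq_eq_enorm_sq]
    refine ENNReal.ofReal_le_ofReal ?_
    have hω0 := truncWeight_nonneg hwa.one_le n v
    have hωw := truncWeight_le hwa.one_le n v
    have hd : (1 / Kn) * (ω v * |localMaxwellian (f (s, x)).fn v -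
        localMaxwellian (g (s, x)).fn v|) ≤
          L * m / Kn * (w v * Real.exp (-c * ‖v‖ ^ 2)) := by
      calc _ ≤ (1 / Kn) * (w v * (L * Real.exp (-c * ‖v‖ ^ 2) * m)) := by
            have := hM v
            have : 0 ≤ w v := zero_le_one.trans (hwa.one_le v)
            gcongr
        _ = _ := by ring
    have hexp : (L * m / Kn * (w v * Real.exp (-c * ‖v‖ ^ 2))) ^ 2 =
        (L * m / Kn) ^ 2 * (w v ^ 2 * Real.exp (-2 * c * ‖v‖ ^ 2)) := by
      rw [mul_pow, mul_pow, ← Real.exp_nat_mul]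
      congr 3
      push_cast
      ring_nf
    have key := source_le (r := r v)
      (P := transport 𝒯 g s x v - relaxation Kn g s x v) hω0 hωw (by positivity) hd
    rw [hexp] at key
    refine le_trans (le_of_eq ?_) key
    have htr : (DR (1, 0)).fn v + ∑ i : Fin 3, v i * (DR (0, Pi.single i 1)).fn v =
        transport 𝒯 f s x v - transport 𝒯 g s x v := by
      simp only [transport, timeDeriv, spaceDeriv, hDR, hRdef]
      rw [h3]
      simp_rw [h4, mul_sub, Finset.sum_sub_distrib]
      ring
    have hsum : 2 * (ω v ^ 2 * r v * (DR (1, 0)).fn v) +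
        ∑ i : Fin 3, 2 * (v i * ω v ^ 2 * r v * (DR (0, Pi.single i 1)).fn v) =
        2 * (ω v ^ 2 * r v * (transport 𝒯 f s x v - transport 𝒯 g s x v)) := by
      rw [← htr, mul_add, mul_add, Finset.mul_sum, Finset.mul_sum]
      congr 1
      refine Finset.sum_congr rfl fun i _ => ?_
      ring
    rw [hsum, h1]
    simp only [relaxation]
    have h2' : r v = (f (s, x)).fn v - (g (s, x)).fn v := h2
    rw [h2']
    ring

theorem timeSpace_subset_closure_interior {𝒯 : ℝ} (h𝒯 : 0 < 𝒯) :
    timeSpace 𝒯 ⊆ closure (interior (timeSpace 𝒯)) := by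
  rw [timeSpace, cube_eq_pi, interior_prod_eq, interior_pi_set finite_univ, closure_prod_eq,
    closure_pi_set]
  simp only [interior_Icc]
  rw [closure_Ioo h𝒯.ne]
  simp [closure_Ioo]

/-- By continuity, the essential bound for the `L²` norm holds everywhere. -/
theorem InAnsatz.norm_toL2_le {M : StructuralConstants} {𝒯 : ℝ} (h𝒯 : 0 < 𝒯)
    {f : ℝ × Pos → VelSpace} (hf : InAnsatz M 𝒯 f) {z : ℝ × Pos} (hz : z ∈ timeSpace 𝒯) :
    ‖VelSpace.toL2 (f z)‖ ≤ M.Cinf := by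
  have hc : ContinuousOn (fun z => ‖VelSpace.toL2 (f z)‖) (timeSpace 𝒯) :=
    (VelSpace.toL2.continuous.comp_continuousOn hf.contDiffOn.continuousOn).norm
  have hae : (fun z => max ‖VelSpace.toL2 (f z)‖ M.Cinf) =ᵐ[volume.restrict (timeSpace 𝒯)]
      fun _ => M.Cinf := by
    filter_upwards [ENNReal.ae_le_essSup (μ := volume.restrict (timeSpace 𝒯))
      (fun z => eLpNorm (f z).fn 2 volume)] with z hz
    refine max_eq_right ?_
    rw [Lp.norm_def]
    exact ENNReal.toReal_le_of_le_ofReal M.Cinf_pos.le (hz.trans hf.norm_le)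
  have := Measure.eqOn_of_ae_eq hae (hc.sup continuousOn_const) continuousOn_const
    (timeSpace_subset_closure_interior h𝒯) hz
  exact (le_max_left _ _).trans this.le

theorem integral_sq_eq_norm_toL2 (g : VelSpace) : ∫ v, g.fn v ^ 2 = ‖VelSpace.toL2 g‖ ^ 2 := by
  rw [← real_inner_self_eq_norm_sq, L2.inner_def]
  refine integral_congr_ae (Eventually.of_forall fun v => ?_)
  simp [VelSpace.coe_toL2, sq]

/-- If the solution has the same value `F` at two opposite boundary points, the flux difference is
controlled by the mismatch `A - B` of the values of the approximation there. -/
theorem flux_le {C η : ℝ} (hC : 0 < C) (hη : 0 < η) {w : Vel → ℝ} (hw : Measurable w)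
    (h1 : ∀ v, 1 ≤ w v) (n : ℕ) (i : Fin 3) {F A B : VelSpace}
    (hF : ‖VelSpace.toL2 F‖ ≤ C) (hA : ‖VelSpace.toL2 A‖ ≤ C) (hB : ‖VelSpace.toL2 B‖ ≤ C) :
    ENNReal.ofReal (-((∫ v, v i * truncWeight w n v ^ 2 * (F - A).fn v * (F - A).fn v) -
        ∫ v, v i * truncWeight w n v ^ 2 * (F - B).fn v * (F - B).fn v) - η) ≤
      ENNReal.ofReal (4 * C ^ 2 / η) *
        ∫⁻ v, ‖v i * w v ^ 2 * (A.fn v - B.fn v)‖ₑ ^ 2 := by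
  have mi := memLp_coord_mul_truncWeight_sq hw h1 n i
  have hA' := integrable_multiplier mi (F - A) (F - A)
  have hB' := integrable_multiplier mi (F - B) (F - B)
  -- In `pq ≤ lam p² + q² / (4 lam)`, with `p` the weighted mismatch and `q` a sum of four functions
  -- of norm at most `C`, this choice of `lam` makes the second term integrate to at most `η`.
  set lam := 4 * C ^ 2 / η with hlam
  have hlam0 : 0 < lam := by positivity
  set S := (F - A) + (F - B) with hS
  have hSint : Integrable (fun v => 1 / (4 * lam) * S.fn v ^ 2) :=
    ((memLp_two_iff_integrable_sq S.aestronglyMeasurable).1 S.memLp).const_mul _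
  have hSn : ‖VelSpace.toL2 S‖ ≤ 4 * C := by
    rw [hS, map_add, map_sub, map_sub]
    refine (norm_add_le _ _).trans ?_
    have := norm_sub_le (VelSpace.toL2 F) (VelSpace.toL2 A)
    have := norm_sub_le (VelSpace.toL2 F) (VelSpace.toL2 B)
    linarith
  rw [← integral_sub hA' hB', ← integral_neg, ← lintegral_const_mul' _ _ ENNReal.ofReal_ne_top]
  refine ofReal_sub_integral_le (hA'.sub hB').neg hSint ?_ ?_
  · rw [integral_const_mul, integral_sq_eq_norm_toL2]
    calc _ ≤ 1 / (4 * lam) * (4 * C) ^ 2 := by gcongr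
      _ = η := by rw [hlam]; field_simp
  · have hadd : S.fn =ᵐ[volume] fun v => (F - A).fn v + (F - B).fn v :=
      Lp.coeFn_add (F - A).1.2 (F - B).1.2
    filter_upwards [hadd, VelSpace.fn_sub F A, VelSpace.fn_sub F B] with v e1 e2 e3
    rw [← ofReal_sq_eq_enorm_sq, ← ENNReal.ofReal_mul hlam0.le]
    refine ENNReal.ofReal_le_ofReal ?_
    rw [e1, e2, e3]
    have hω0 := truncWeight_nonneg h1 n v
    have hωw := truncWeight_le h1 n v
    set p := v i * truncWeight w n v ^ 2 * (A.fn v - B.fn v) with hp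
    set q := F.fn v - A.fn v + (F.fn v - B.fn v) with hq
    have h5 : p * q ≤ lam * p ^ 2 + 1 / (4 * lam) * q ^ 2 := by
      have h6 : lam * p ^ 2 + 1 / (4 * lam) * q ^ 2 - p * q = lam * (p - q / (2 * lam)) ^ 2 := by
        field_simp; ring
      have : 0 ≤ lam * (p - q / (2 * lam)) ^ 2 := by positivity
      linarith
    have h7 : p ^ 2 ≤ (v i * w v ^ 2 * (A.fn v - B.fn v)) ^ 2 := by
      rw [hp, mul_pow, mul_pow, mul_pow, mul_pow]
      gcongr
    have h8 := mul_le_mul_of_nonneg_left h7 hlam0.le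
    refine le_trans (le_of_eq ?_) ((sub_le_iff_le_add.2 h5).trans h8)
    rw [hp, hq]
    ring

/-! ### The weighted stability estimate -/

theorem volume_cube : (volume : Measure Pos) cube = 1 := by
  simp [cube, Real.volume_Icc_pi]

theorem quadForm_nonneg {ω : Vel → ℝ} (R : ℝ × Pos → VelSpace) (z : ℝ × Pos) :
    0 ≤ quadForm (fun v => ω v ^ 2) R z :=
  integral_nonneg fun v => by
    simp only [Pi.zero_apply]
    rw [mul_assoc]
    exact mul_nonneg (sq_nonneg _) (mul_self_nonneg _)

theorem tendsto_integral_tail_sq {𝒯 β : ℝ} {w : Vel → ℝ} (hw : Measurable w)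
    {R : ℝ × Pos → VelSpace} (hR : ContinuousOn R (timeSpace 𝒯)) :
    Tendsto (fun n => ∫ s in Icc 0 𝒯, ∫ x in cube, β * tail w n (R (s, x)) ^ 2) atTop (𝓝 0) := by
  have hc : ∀ n, ContinuousOn (fun z => β * tail w n (R z) ^ 2) (timeSpace 𝒯) := fun n =>
    continuousOn_const.mul (((continuous_tail n).comp_continuousOn hR).pow 2)
  obtain ⟨C, hC⟩ := (isCompact_timeSpace 𝒯).exists_bound_of_continuousOn (hc 0)
  have hbd : ∀ n, ∀ z ∈ timeSpace 𝒯, ‖β * tail w n (R z) ^ 2‖ ≤ C := fun n z hz => by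
    refine le_trans ?_ (hC z hz)
    rw [norm_mul, norm_mul, norm_pow, norm_pow, Real.norm_of_nonneg (tail_nonneg n _),
      Real.norm_of_nonneg (tail_nonneg 0 _)]
    have := tail_le hw n (R z)
    have := tail_nonneg (w := w) n (R z)
    gcongr
  have hinner : ∀ s ∈ Icc 0 𝒯,
      Tendsto (fun n => ∫ x in cube, β * tail w n (R (s, x)) ^ 2) atTop (𝓝 0) := by
    intro s hs
    have h := tendsto_integral_of_dominated_convergence (μ := volume.restrict cube)
      (F := fun n x => β * tail w n (R (s, x)) ^ 2) (f := fun _ => 0) (fun _ => C)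
      (fun n => ((hc n).comp (f := fun x : Pos => (s, x)) (by fun_prop)
        (fun x hx => ⟨hs, hx⟩)).aestronglyMeasurable isCompact_cube.measurableSet)
      (integrableOn_const isCompact_cube.measure_lt_top.ne)
      (fun n => by
        filter_upwards [ae_restrict_mem isCompact_cube.measurableSet] with x hx
        exact hbd n _ ⟨hs, hx⟩)
      (Eventually.of_forall fun x => by
        simpa using ((tendsto_tail hw (R (s, x))).pow 2).const_mul β)
    simpa using h
  have h := tendsto_integral_of_dominated_convergence (μ := volume.restrict (Icc 0 𝒯))
    (F := fun n s => ∫ x in cube, β * tail w n (R (s, x)) ^ 2) (f := fun _ => 0) (fun _ => C)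
    (fun n => (continuousOn_setIntegral isCompact_Icc isCompact_cube (hc n)).aestronglyMeasurable
      measurableSet_Icc)
    (integrableOn_const measure_Icc_lt_top.ne)
    (fun n => by
      filter_upwards [ae_restrict_mem measurableSet_Icc] with s hs
      have := norm_setIntegral_le_of_norm_le_const (μ := volume) (s := cube) (C := C)
        (f := fun x => β * tail w n (R (s, x)) ^ 2)
        isCompact_cube.measure_lt_top (fun x hx => hbd n _ ⟨hs, hx⟩)
      simpa [Measure.real, volume_cube] using this)
    (by
      filter_upwards [ae_restrict_mem measurableSet_Icc] with s hs
      exact hinner s hs)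
  simpa using h

/-- By Fatou's lemma in `v` and in `x`, the energies with truncated weight control the full weighted
energy, which may be infinite a priori. -/
theorem lintegral_enorm_sq_le_liminf {w : Vel → ℝ} (hw : Measurable w)
    (h1 : ∀ v, 1 ≤ w v) {𝒯 : ℝ} {R : ℝ × Pos → VelSpace} (hR : ContDiffOn ℝ 1 R (timeSpace 𝒯))
    {t : ℝ} (ht : t ∈ Icc 0 𝒯) :
    ∫⁻ x in cube, ∫⁻ v, ‖w v * (R (t, x)).fn v‖ₑ ^ 2 ≤
      liminf (fun n => ENNReal.ofReal (∫ x in cube,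
        quadForm (fun v => truncWeight w n v ^ 2) R (t, x))) atTop := by
  have m0 := memLp_truncWeight_sq hw h1
  have hφ : ∀ n, ContinuousOn (fun x => quadForm (fun v => truncWeight w n v ^ 2) R (t, x)) cube :=
    fun n => (contDiffOn_quadForm (m0 n) hR).continuousOn.comp (f := fun x : Pos => (t, x))
      (by fun_prop) (fun x hx => ⟨ht, hx⟩)
  have hinner : ∀ x, ∫⁻ v, ‖w v * (R (t, x)).fn v‖ₑ ^ 2 ≤ liminf (fun n => ENNReal.ofReal
      (quadForm (fun v => truncWeight w n v ^ 2) R (t, x))) atTop := by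
    intro x
    have hq : ∀ n, ENNReal.ofReal (quadForm (fun v => truncWeight w n v ^ 2) R (t, x)) =
        ∫⁻ v, ENNReal.ofReal (truncWeight w n v ^ 2 * (R (t, x)).fn v * (R (t, x)).fn v) := by
      intro n
      refine ofReal_integral_eq_lintegral_ofReal (integrable_multiplier (m0 n) _ _)
        (Eventually.of_forall fun v => ?_)
      simp only [Pi.zero_apply]
      rw [mul_assoc]
      exact mul_nonneg (sq_nonneg _) (mul_self_nonneg _)
    simp_rw [hq]
    refine le_trans (lintegral_mono fun v => ?_) (lintegral_liminf_le' fun n =>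
      (integrable_multiplier (m0 n) _ _).aestronglyMeasurable.aemeasurable.ennreal_ofReal)
    refine le_of_eq (Tendsto.liminf_eq (tendsto_const_nhds.congr' ?_)).symm
    filter_upwards [eventually_mem_truncSet w v] with n hn
    rw [← ofReal_sq_eq_enorm_sq, truncWeight, indicator_of_mem hn]
    congr 1
    ring
  calc _ ≤ ∫⁻ x in cube, liminf (fun n => ENNReal.ofReal
          (quadForm (fun v => truncWeight w n v ^ 2) R (t, x))) atTop := lintegral_mono hinner
    _ ≤ liminf (fun n => ∫⁻ x in cube, ENNReal.ofReal
          (quadForm (fun v => truncWeight w n v ^ 2) R (t, x))) atTop :=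
        lintegral_liminf_le' fun n =>
          ((hφ n).aemeasurable isCompact_cube.measurableSet).ennreal_ofReal
    _ = _ := by
        congr 1
        funext n
        exact (ofReal_integral_eq_lintegral_ofReal ((hφ n).integrableOn_compact isCompact_cube)
          (Eventually.of_forall fun x => quadForm_nonneg _ _)).symm

/-- The stability estimate behind the convergence: for a measurable weight and every `η > 0`, the
weighted `L²` distance to the solution at time `t` is bounded by the three parts of the
loss and a multiple of `η`. -/
theorem exists_weighted_stability {M : StructuralConstants} {c : ℝ} (hc : IsMaxwellianExponent M c)
    {w : Vel → ℝ} (hw : Measurable w) (hwa : IsAdmissibleWeight c w) {𝒯 Kn : ℝ} (h𝒯 : 0 < 𝒯)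
    (hKn : 0 < Kn) :
    ∃ C : ℝ, ∀ (f₀ : Pos → Vel → ℝ) (f g : ℝ × Pos → VelSpace), InAnsatz M 𝒯 f →
      IsSolution 𝒯 Kn f₀ f → InAnsatz M 𝒯 g → ∀ t ∈ Icc 0 𝒯, ∀ η : ℝ, 0 < η →
      ∫⁻ x in cube, ∫⁻ v, ‖w v * ((f (t, x)).fn v - (g (t, x)).fn v)‖ₑ ^ 2 ≤
        ENNReal.ofReal C * (lossIni w f₀ g + lossPde 𝒯 Kn w g +
          ENNReal.ofReal (4 * M.Cinf ^ 2 / η) * lossBc 𝒯 w g + ENNReal.ofReal (3 * 𝒯 * η)) := by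
  obtain ⟨-, L, hL, hLM⟩ := hc
  set G := ∫ v, w v ^ 2 * Real.exp (-2 * c * ‖v‖ ^ 2) with hG
  set K := ∫ v : Vel, (1 + ‖v‖ ^ 2) ^ 2 / w v ^ 2 with hK
  have hG0 : 0 ≤ G := integral_nonneg fun v => by positivity
  have hK0 : 0 ≤ K := integral_nonneg fun v => by positivity
  set β := 2 * ((L / Kn) ^ 2 * G) with hβ
  have hβ0 : 0 ≤ β := by positivity
  set a := 2 + β * K with ha
  have ha0 : 0 ≤ a := by positivity
  refine ⟨Real.exp (a * 𝒯), ?_⟩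
  intro f₀ f g hf hsol hg t ht η hη
  set R : ℝ × Pos → VelSpace := fun z => f z - g z with hR
  have hRc : ContDiffOn ℝ 1 R (timeSpace 𝒯) := hf.contDiffOn.sub hg.contDiffOn
  have hRfn : ∀ t x, ∫⁻ v, ‖w v * ((f (t, x)).fn v - (g (t, x)).fn v)‖ₑ ^ 2 =
      ∫⁻ v, ‖w v * (R (t, x)).fn v‖ₑ ^ 2 := by
    intro t x
    refine lintegral_congr_ae ?_
    filter_upwards [VelSpace.fn_sub (f (t, x)) (g (t, x))] with v hv
    simp only [hR, hv]
  have m0 := memLp_truncWeight_sq hw hwa.one_le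
  have mi := memLp_coord_mul_truncWeight_sq hw hwa.one_le
  set φ : ℕ → ℝ × Pos → ℝ := fun n => quadForm (fun v => truncWeight w n v ^ 2) R with hφ
  set Θ : ℕ → ℝ := fun n => ∫ s in Icc 0 𝒯, ∫ x in cube, β * tail w n (R (s, x)) ^ 2 with hΘ
  have hest : ∀ n, ENNReal.ofReal (∫ x in cube, φ n (t, x)) ≤
      ENNReal.ofReal (Real.exp (a * 𝒯)) * (lossIni w f₀ g + lossPde 𝒯 Kn w g +
          ENNReal.ofReal (4 * M.Cinf ^ 2 / η) * lossBc 𝒯 w g + ENNReal.ofReal (3 * 𝒯 * η) +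
          ENNReal.ofReal (Θ n)) := by
    intro n
    have h := energy_le h𝒯 (φ := φ n) (τ := fun z => β * tail w n (R z) ^ 2)
      (ψ := fun i => quadForm (fun v => v i * truncWeight w n v ^ 2) R)
      (contDiffOn_quadForm (m0 n) hRc) (fun i => contDiffOn_quadForm (mi n i) hRc)
      (continuousOn_const.mul (((continuous_tail n).comp_continuousOn hRc.continuousOn).pow 2))
      (fun z => by positivity) ha0 hη.le
      (q := fun s x => ∫⁻ v, ‖w v * (transport 𝒯 g s x v - relaxation Kn g s x v)‖ₑ ^ 2)
      (b := fun i s y => ENNReal.ofReal (4 * M.Cinf ^ 2 / η) * ∫⁻ v, ‖v i * w v ^ 2 *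
        ((g (s, i.insertNth (1 : ℝ) y)).fn v - (g (s, i.insertNth (0 : ℝ) y)).fn v)‖ₑ ^ 2)
      (fun s hs x hx => by
        have hz : (s, x) ∈ timeSpace 𝒯 := ⟨Ioo_subset_Icc_self hs, by
          rw [cube_eq_pi]; exact fun i _ => Ioo_subset_Icc_self (hx i)⟩
        exact source_term_le h𝒯 hKn hL hw hwa hf.contDiffOn hg.contDiffOn hz
          (hLM 𝒯 h𝒯 f g hf hg _ hz) (hsol.equation s hs x hx) n hβ)
      (fun i s hs y hy => by
        have z1 : (s, (i.insertNth (1 : ℝ) y : Pos)) ∈ timeSpace 𝒯 :=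
          ⟨hs, insertNth_mem_cube (by simp) hy⟩
        have z0 : (s, (i.insertNth (0 : ℝ) y : Pos)) ∈ timeSpace 𝒯 :=
          ⟨hs, insertNth_mem_cube (by simp) hy⟩
        simp only [quadForm, hR]
        rw [hsol.periodic s hs i y hy]
        exact flux_le M.Cinf_pos hη hw hwa.one_le n i (hf.norm_toL2_le h𝒯 z0)
          (hg.norm_toL2_le h𝒯 z1) (hg.norm_toL2_le h𝒯 z0))
      ht
    have hini : ENNReal.ofReal (∫ x in cube, φ n (0, x)) ≤ lossIni w f₀ g := by
      refine (ofReal_integral_le_lintegral _ _).trans (lintegral_mono_ae ?_)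
      filter_upwards [ae_restrict_mem isCompact_cube.measurableSet] with x hx
      refine (ofReal_integral_le_lintegral _ _).trans (lintegral_mono_ae ?_)
      filter_upwards [VelSpace.fn_sub (f (0, x)) (g (0, x)), hsol.initial x hx] with v h2 h3
      rw [← ofReal_sq_eq_enorm_sq]
      refine ENNReal.ofReal_le_ofReal ?_
      simp only [hR, h2, h3]
      have := truncWeight_nonneg hwa.one_le n v
      calc _ = truncWeight w n v ^ 2 * ((g (0, x)).fn v - f₀ x v) ^ 2 := by ring
        _ ≤ w v ^ 2 * ((g (0, x)).fn v - f₀ x v) ^ 2 := by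
            gcongr
            exact truncWeight_le hwa.one_le n v
        _ = _ := by ring
    have hbc : ∑ i : Fin 3, (∫⁻ s in Icc 0 𝒯, ∫⁻ y in Icc (0 : Fin 2 → ℝ) 1,
        ENNReal.ofReal (4 * M.Cinf ^ 2 / η) * ∫⁻ v, ‖v i * w v ^ 2 *
        ((g (s, i.insertNth (1 : ℝ) y)).fn v - (g (s, i.insertNth (0 : ℝ) y)).fn v)‖ₑ ^ 2) =
        ENNReal.ofReal (4 * M.Cinf ^ 2 / η) * lossBc 𝒯 w g := by
      rw [lossBc, Finset.mul_sum]
      refine Finset.sum_congr rfl fun i _ => ?_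
      rw [← lintegral_const_mul' _ _ ENNReal.ofReal_ne_top]
      simp_rw [lintegral_const_mul' _ _ ENNReal.ofReal_ne_top]
    rw [hbc] at h
    refine h.trans ?_
    gcongr
    exact le_rfl
  simp_rw [hRfn]
  refine (lintegral_enorm_sq_le_liminf hw hwa.one_le hRc ht).trans ?_
  refine (liminf_le_liminf (Eventually.of_forall hest)).trans (le_of_eq (Tendsto.liminf_eq ?_))
  refine ENNReal.Tendsto.const_mul ?_ (Or.inr ENNReal.ofReal_ne_top)
  have hΘ0 : Tendsto (fun n => ENNReal.ofReal (Θ n)) atTop (𝓝 0) := by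
    simpa using ENNReal.tendsto_ofReal (tendsto_integral_tail_sq (β := β) hw hRc.continuousOn)
  simpa using hΘ0.const_add (lossIni w f₀ g + lossPde 𝒯 Kn w g +
          ENNReal.ofReal (4 * M.Cinf ^ 2 / η) * lossBc 𝒯 w g + ENNReal.ofReal (3 * 𝒯 * η))

/-! ### Convergence -/

/-- An admissible weight is almost everywhere measurable, because `(1+|v|²)²/w²` is; it may
therefore be replaced by a Borel function. -/
theorem IsAdmissibleWeight.exists_measurable {c : ℝ} {w : Vel → ℝ} (hw : IsAdmissibleWeight c w) :
    ∃ w' : Vel → ℝ, Measurable w' ∧ IsAdmissibleWeight c w' ∧ w =ᵐ[volume] w' := by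
  have hsq : AEMeasurable (fun v => w v ^ 2) := by
    have h : AEMeasurable (fun v : Vel => (1 + ‖v‖ ^ 2) ^ 2 / ((1 + ‖v‖ ^ 2) ^ 2 / w v ^ 2)) :=
      AEMeasurable.div (by fun_prop) hw.integrable_inv.aestronglyMeasurable.aemeasurable
    refine h.congr (Eventually.of_forall fun v => ?_)
    have : 0 < w v := zero_lt_one.trans_le (hw.one_le v)
    simp only
    field_simp
  have hm : AEMeasurable w := by
    refine hsq.sqrt.congr (Eventually.of_forall fun v => ?_)
    exact Real.sqrt_sq (zero_le_one.trans (hw.one_le v))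
  have he : w =ᵐ[volume] fun v => max 1 (hm.mk w v) := by
    filter_upwards [hm.ae_eq_mk] with v hv
    rw [← hv, max_eq_right (hw.one_le v)]
  refine ⟨fun v => max 1 (hm.mk w v), measurable_const.max hm.measurable_mk,
    ⟨fun v => le_max_left _ _, hw.integrable_inv.congr ?_, hw.integrable_gauss.congr ?_⟩, he⟩
  · filter_upwards [he] with v hv
    rw [← hv]
  · filter_upwards [he] with v hv
    rw [← hv]

theorem weightedLoss_congr {w w' : Vel → ℝ} (h : w =ᵐ[volume] w') (𝒯 Kn lamBc lamIni : ℝ)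
    (f₀ : Pos → Vel → ℝ) (f : ℝ × Pos → VelSpace) :
    weightedLoss 𝒯 Kn lamBc lamIni w f₀ f = weightedLoss 𝒯 Kn lamBc lamIni w' f₀ f := by
  have key : ∀ F : ℝ → Vel → ℝ≥0∞, ∫⁻ v, F (w v) v = ∫⁻ v, F (w' v) v := fun F =>
    lintegral_congr_ae (by filter_upwards [h] with v hv; rw [hv])
  have hP : lossPde 𝒯 Kn w f = lossPde 𝒯 Kn w' f :=
    lintegral_congr fun t => lintegral_congr fun x =>
      key fun a v => ‖a * (transport 𝒯 f t x v - relaxation Kn f t x v)‖ₑ ^ 2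
  have hB : lossBc 𝒯 w f = lossBc 𝒯 w' f :=
    Finset.sum_congr rfl fun i _ => lintegral_congr fun t => lintegral_congr fun y =>
      key fun a v => ‖v i * a ^ 2 * ((f (t, i.insertNth (1 : ℝ) y)).fn v -
        (f (t, i.insertNth (0 : ℝ) y)).fn v)‖ₑ ^ 2
  have hI : lossIni w f₀ f = lossIni w' f₀ f :=
    lintegral_congr fun x => key fun a v => ‖a * ((f (0, x)).fn v - f₀ x v)‖ₑ ^ 2
  rw [weightedLoss, weightedLoss, hP, hB, hI]

theorem tendsto_of_const_mul_le {ι : Type*} {l : Filter ι} {u a : ι → ℝ≥0∞} {lam : ℝ}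
    (hlam : 0 < lam) (hu : Tendsto u l (𝓝 0)) (h : ∀ i, ENNReal.ofReal lam * a i ≤ u i) :
    Tendsto a l (𝓝 0) := by
  have h0 : ENNReal.ofReal lam ≠ 0 := by simpa using hlam
  have h1 : Tendsto (fun i => (ENNReal.ofReal lam)⁻¹ * u i) l (𝓝 0) := by
    simpa using ENNReal.Tendsto.const_mul hu (Or.inr (ENNReal.inv_ne_top.2 h0))
  refine tendsto_of_tendsto_of_tendsto_of_le_of_le tendsto_const_nhds h1 (fun _ => zero_le)
    fun i => ?_
  calc a i = (ENNReal.ofReal lam)⁻¹ * (ENNReal.ofReal lam * a i) := by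
        rw [← mul_assoc, ENNReal.inv_mul_cancel h0 ENNReal.ofReal_ne_top, one_mul]
    _ ≤ _ := by gcongr; exact h i

theorem tendsto_weighted_energy {M : StructuralConstants} {c : ℝ} (hc : IsMaxwellianExponent M c)
    {w : Vel → ℝ} (hwa : IsAdmissibleWeight c w) {𝒯 Kn lamBc lamIni : ℝ} (h𝒯 : 0 < 𝒯)
    (hKn : 0 < Kn) (hbc : 0 < lamBc) (hini : 0 < lamIni) {f₀ : Pos → Vel → ℝ}
    {f : ℝ × Pos → VelSpace} (hf : InAnsatz M 𝒯 f) (hsol : IsSolution 𝒯 Kn f₀ f)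
    {ι : Type*} {l : Filter ι} {g : ι → ℝ × Pos → VelSpace} (hg : ∀ i, InAnsatz M 𝒯 (g i))
    (hloss : Tendsto (fun i => weightedLoss 𝒯 Kn lamBc lamIni w f₀ (g i)) l (𝓝 0))
    {t : ℝ} (ht : t ∈ Icc 0 𝒯) :
    Tendsto (fun i => ∫⁻ x in cube, ∫⁻ v,
      ‖w v * ((f (t, x)).fn v - (g i (t, x)).fn v)‖ₑ ^ 2) l (𝓝 0) := by
  obtain ⟨w', hw'm, hw'a, hww'⟩ := hwa.exists_measurable
  simp_rw [weightedLoss_congr hww'] at hloss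
  have hcongr : ∀ i x, ∫⁻ v, ‖w v * ((f (t, x)).fn v - (g i (t, x)).fn v)‖ₑ ^ 2 =
      ∫⁻ v, ‖w' v * ((f (t, x)).fn v - (g i (t, x)).fn v)‖ₑ ^ 2 := fun i x =>
    lintegral_congr_ae (by filter_upwards [hww'] with v hv; rw [hv])
  simp_rw [hcongr]
  obtain ⟨C, hC⟩ := exists_weighted_stability hc hw'm hw'a h𝒯 hKn
  have hP : Tendsto (fun i => lossPde 𝒯 Kn w' (g i)) l (𝓝 0) :=
    tendsto_of_tendsto_of_tendsto_of_le_of_le tendsto_const_nhds hloss (fun _ => zero_le)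
      fun i => le_self_add.trans le_self_add
  have hB : Tendsto (fun i => lossBc 𝒯 w' (g i)) l (𝓝 0) :=
    tendsto_of_const_mul_le hbc hloss fun i => le_add_self.trans le_self_add
  have hI : Tendsto (fun i => lossIni w' f₀ (g i)) l (𝓝 0) :=
    tendsto_of_const_mul_le hini hloss fun i => le_add_self
  rw [ENNReal.tendsto_nhds_zero]
  intro ε hε
  -- The boundary mismatch enters the estimate linearly, hence the free parameter `η`: it is fixed
  -- before the loss is sent to zero.
  have hη : Tendsto (fun η : ℝ => ENNReal.ofReal C * ENNReal.ofReal (3 * 𝒯 * η)) (𝓝[>] 0)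
      (𝓝 0) := by
    have h : Continuous fun η : ℝ => ENNReal.ofReal C * ENNReal.ofReal (3 * 𝒯 * η) :=
      (ENNReal.continuous_const_mul ENNReal.ofReal_ne_top).comp
        (ENNReal.continuous_ofReal.comp (by fun_prop))
    simpa using (h.tendsto 0).mono_left nhdsWithin_le_nhds
  obtain ⟨η, hηε, hη0⟩ := ((hη.eventually (gt_mem_nhds hε)).and self_mem_nhdsWithin).exists
  have hlim : Tendsto (fun i => ENNReal.ofReal C * (lossIni w' f₀ (g i) + lossPde 𝒯 Kn w' (g i) +
      ENNReal.ofReal (4 * M.Cinf ^ 2 / η) * lossBc 𝒯 w' (g i) + ENNReal.ofReal (3 * 𝒯 * η))) l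
      (𝓝 (ENNReal.ofReal C * ENNReal.ofReal (3 * 𝒯 * η))) := by
    refine ENNReal.Tendsto.const_mul ?_ (Or.inr ENNReal.ofReal_ne_top)
    have h1 := (hI.add hP).add (ENNReal.Tendsto.const_mul hB
      (Or.inr (ENNReal.ofReal_ne_top (r := 4 * M.Cinf ^ 2 / η))))
    simpa using h1.add (tendsto_const_nhds (x := ENNReal.ofReal (3 * 𝒯 * η)))
  filter_upwards [hlim.eventually (gt_mem_nhds hηε)] with i hi
  exact (hC f₀ f (g i) hf hsol (hg i) t ht η hη0).trans hi.le

/-- Interpolation: for `1 ≤ p ≤ 2`, `|r|^p ≤ |r| + r²`, and `|r|` is split by Young's inequality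
into the integrable function `(1+|v|²)²/w²` and the weighted energy density. -/
theorem rpow_enorm_le {w r y p δ : ℝ} (hw : 1 ≤ w) (hy : 0 ≤ y) (hp1 : 1 ≤ p) (hp2 : p ≤ 2)
    (hδ : 0 < δ) :
    ‖r‖ₑ ^ p ≤ ENNReal.ofReal (δ * ((1 + y) ^ 2 / w ^ 2)) +
      ENNReal.ofReal (1 / δ + 1) * ‖w * r‖ₑ ^ 2 := by
  have hw0 : 0 < w := zero_lt_one.trans_le hw
  have h1 : |r| ^ p ≤ |r| + |r| ^ 2 := by
    rcases le_total |r| 1 with h | h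
    · have : |r| ^ p ≤ |r| ^ (1 : ℝ) :=
        Real.rpow_le_rpow_of_exponent_ge' (abs_nonneg r) h zero_le_one hp1
      rw [Real.rpow_one] at this
      nlinarith [sq_nonneg |r|]
    · have : |r| ^ p ≤ |r| ^ (2 : ℝ) := Real.rpow_le_rpow_of_exponent_le h hp2
      rw [Real.rpow_two] at this
      nlinarith [abs_nonneg r]
  have h2 : |r| ≤ δ * (1 / w ^ 2) + 1 / δ * (w * r) ^ 2 := by
    have e : δ * (1 / w ^ 2) + 1 / δ * (w * r) ^ 2 - 2 * |r| = (δ / w - w * |r|) ^ 2 / δ := by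
      rw [mul_pow, ← sq_abs r]
      field_simp
      ring
    have : 0 ≤ (δ / w - w * |r|) ^ 2 / δ := by positivity
    linarith [abs_nonneg r]
  have h3 : |r| ^ 2 ≤ (w * r) ^ 2 := by
    rw [sq_abs, mul_pow]
    exact le_mul_of_one_le_left (sq_nonneg r) (one_le_pow₀ hw)
  have h4 : δ * (1 / w ^ 2) ≤ δ * ((1 + y) ^ 2 / w ^ 2) := by
    have : 1 ≤ (1 + y) ^ 2 := one_le_pow₀ (by linarith)
    gcongr
  rw [← ofReal_sq_eq_enorm_sq, ← ENNReal.ofReal_mul (by positivity),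
    ← ENNReal.ofReal_add (by positivity) (by positivity), Real.enorm_eq_ofReal_abs,
    ENNReal.ofReal_rpow_of_nonneg (abs_nonneg r) (by linarith)]
  refine ENNReal.ofReal_le_ofReal ?_
  linarith

theorem tendsto_lintegral_rpow {c : ℝ} {w : Vel → ℝ} (hwa : IsAdmissibleWeight c w) {ι : Type*}
    {l : Filter ι} {r : ι → Pos → Vel → ℝ}
    (h : Tendsto (fun i => ∫⁻ x in cube, ∫⁻ v, ‖w v * r i x v‖ₑ ^ 2) l (𝓝 0)) {p : ℝ}
    (hp1 : 1 ≤ p) (hp2 : p ≤ 2) :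
    Tendsto (fun i => ∫⁻ x in cube, ∫⁻ v, ‖r i x v‖ₑ ^ p) l (𝓝 0) := by
  set K := ∫ v : Vel, (1 + ‖v‖ ^ 2) ^ 2 / w v ^ 2 with hK
  have hbound : ∀ δ : ℝ, 0 < δ → ∀ i, ∫⁻ x in cube, ∫⁻ v, ‖r i x v‖ₑ ^ p ≤
      ENNReal.ofReal (δ * K) +
        ENNReal.ofReal (1 / δ + 1) * ∫⁻ x in cube, ∫⁻ v, ‖w v * r i x v‖ₑ ^ 2 := by
    intro δ hδ i
    have hint := hwa.integrable_inv.const_mul δ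
    have hin : ∀ x, ∫⁻ v, ‖r i x v‖ₑ ^ p ≤ ENNReal.ofReal (δ * K) +
        ENNReal.ofReal (1 / δ + 1) * ∫⁻ v, ‖w v * r i x v‖ₑ ^ 2 := by
      intro x
      refine (lintegral_mono fun v => rpow_enorm_le (hwa.one_le v) (sq_nonneg ‖v‖) hp1 hp2
        hδ).trans ?_
      rw [lintegral_add_left' hint.aestronglyMeasurable.aemeasurable.ennreal_ofReal,
        lintegral_const_mul' _ _ ENNReal.ofReal_ne_top,
        ← ofReal_integral_eq_lintegral_ofReal hint
          (Eventually.of_forall fun v => by simp only [Pi.zero_apply]; positivity),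
        integral_const_mul]
    refine (lintegral_mono hin).trans ?_
    rw [lintegral_add_left measurable_const, lintegral_const_mul' _ _ ENNReal.ofReal_ne_top]
    simp [volume_cube]
  rw [ENNReal.tendsto_nhds_zero]
  intro ε hε
  have hδ : Tendsto (fun δ : ℝ => ENNReal.ofReal (δ * K)) (𝓝[>] 0) (𝓝 0) := by
    have h : Continuous fun δ : ℝ => ENNReal.ofReal (δ * K) :=
      ENNReal.continuous_ofReal.comp (by fun_prop)
    simpa using (h.tendsto 0).mono_left nhdsWithin_le_nhds
  obtain ⟨δ, hδε, hδ0⟩ := ((hδ.eventually (gt_mem_nhds hε)).and self_mem_nhdsWithin).exists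
  have hlim : Tendsto (fun i => ENNReal.ofReal (δ * K) +
        ENNReal.ofReal (1 / δ + 1) * ∫⁻ x in cube, ∫⁻ v, ‖w v * r i x v‖ₑ ^ 2) l
      (𝓝 (ENNReal.ofReal (δ * K))) := by
    simpa using tendsto_const_nhds.add (ENNReal.Tendsto.const_mul h
      (Or.inr (ENNReal.ofReal_ne_top (r := 1 / δ + 1))))
  filter_upwards [hlim.eventually (gt_mem_nhds hδε)] with i hi
  exact (hbound δ hδ0 i).trans hi.le

theorem tendsto_phaseNorm {ι : Type*} {l : Filter ι} {r : ι → Pos → Vel → ℝ} {p : ℝ} (hp : 0 < p)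
    (h : Tendsto (fun i => ∫⁻ x in cube, ∫⁻ v, ‖r i x v‖ₑ ^ p) l (𝓝 0)) :
    Tendsto (fun i => phaseNorm p (r i)) l (𝓝 0) := by
  have hp' : 0 < 1 / p := by positivity
  have := (ENNReal.continuous_rpow_const (y := 1 / p)).tendsto 0 |>.comp h
  rwa [ENNReal.zero_rpow_of_pos hp'] at this

end BGK

end

theorem mainTheorem2 (M : BGK.StructuralConstants) :
    (∃ c : ℝ, BGK.IsMaxwellianExponent M c) ∧
    ∀ c : ℝ, BGK.IsMaxwellianExponent M c →
    ∀ w : BGK.Vel → ℝ, BGK.IsAdmissibleWeight c w →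
    ∀ 𝒯 Kn lamBc lamIni : ℝ, 0 < 𝒯 → 0 < Kn → 0 < lamBc → 0 < lamIni →
    ∀ (f₀ : BGK.Pos → BGK.Vel → ℝ) (f : ℝ × BGK.Pos → BGK.VelSpace),
      BGK.InAnsatz M 𝒯 f → BGK.IsSolution 𝒯 Kn f₀ f →
    ∀ {ι : Type*} (l : Filter ι) (fApprox : ι → ℝ × BGK.Pos → BGK.VelSpace),
      (∀ i, BGK.InAnsatz M 𝒯 (fApprox i)) →
      Filter.Tendsto (fun i => BGK.weightedLoss 𝒯 Kn lamBc lamIni w f₀ (fApprox i)) l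
        (nhds 0) →
      ∀ t ∈ Set.Icc 0 𝒯,
        Filter.Tendsto (fun i => BGK.phaseNorm 2
            (fun x v => w v * ((f (t, x)).fn v - (fApprox i (t, x)).fn v))) l (nhds 0) ∧
        ∀ p : ℝ, 1 ≤ p → p ≤ 2 →
          Filter.Tendsto (fun i => BGK.phaseNorm p
            (fun x v => (f (t, x)).fn v - (fApprox i (t, x)).fn v)) l (nhds 0) := by
  refine ⟨BGK.exists_isMaxwellianExponent M, ?_⟩
  intro c hc w hw 𝒯 Kn lamBc lamIni h𝒯 hKn hbc hini f₀ f hf hsol ι l g hg hloss t ht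
  have h := BGK.tendsto_weighted_energy hc hw h𝒯 hKn hbc hini hf hsol hg hloss ht
  refine ⟨BGK.tendsto_phaseNorm two_pos ?_, fun p hp1 hp2 => BGK.tendsto_phaseNorm (by linarith)
    (BGK.tendsto_lintegral_rpow hw h hp1 hp2)⟩
  simpa only [ENNReal.rpow_two] using h
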